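/- Let $(C,o)\subset(\mathbb C^2,o)$ be an irreducible plane curve singularity with local ring $\mathcal O=\mathcal O_{C,o}$ and normalization (Puiseux parametrization) $n:(\mathbb C,0)\to(C,o)$. For $f\in\mathcal O$ put $\mathfrak v(f)=\mathrm{ord}_t(n^*f)\in\mathbb N\cup\{\infty\}$. Let $\mathcal S=\mathfrak v(\mathcal O)\cap\mathbb N$ be the semigroup of values, $\beta_0<\dots<\beta_g$ its minimal generating set, and $\delta=\#(\mathbb N\setminus\mathcal S)$. For $\ell\in\mathbb N$ let $\mathfrak h(\ell)=\dim_{\mathbb C}\mathcal O/\{f\in\mathcal O:\mathfrak v(f)\ge \ell\}$ and $w_0(\ell)=2\mathfrak h(\ell)-\ell$. For real $x\ge 0$ let $w(x)=\max\{w_0(\lfloor x\rfloor),w_0(\lceil x\rceil)\}$. For $n\in\mathbb Z$ let $S_n=\{x\in\mathbb R_{\ge 0}: w(x)\le n\}$ and $\mathbb H^0_{2n}=H^0(S_n,\mathbb Z)$. The group $\mathbb H^0=\bigoplus_{n\in\mathbb Z}\mathbb H^0_{2n}$ is a $\mathbb Z[U]$-module, where $U:\mathbb H^0_{2n}\to\mathbb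 H^0_{2n-2}$ is the restriction along $S_{n-1}\subseteq S_n$. Let $\mathbb M_{\ge 2n}$ be the $\mathbb Z[U]$-submodule generated by $\bigoplus_{k\ge n}\mathbb H^0_{2k}$, and let $T$ be the $\mathbb Z[U]$-submodule generated by $\bigoplus_{k>0}\mathbb H^0_{2k}$. Let $\mathfrak N$ be the set of integers $n\ge\min w_0$ such that $U$ acts trivially on $\mathbb M_{\ge 2n}/T$ (that is, $U\cdot\mathbb M_{\ge 2n}\subseteq T$). Then $\mathfrak N$ has a least element $e$. Define the initial part of $\mathcal S$ as $$\mathcal E=\mathcal E_e=\{\,s\in\mathcal S : w_0(s)\ge e \text{ and } s\le\delta\,\}.$$ 1. If $g\ge 2$ (i.e. $\mathcal S$ is minimally generated by at least three elements), then $\beta_{g-1}\in\mathcal E$, and moreover $\{\beta_0,\dots,\beta_{g-1}\}\subset\mathcal E$. 2. If $\mathcal E=\{0\}$, then $g\le 1$, i.e. $\mathcal S=\langle a,b\rangle$ for some integers $a,b\ge 1$ with $\gcd(a,b)=1$. -/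

import Mathlib

open Filter Topology Polynomial

noncomputable section

/-! ### Germs of holomorphic functions -/

instance germAlgebra {α : Type*} (l : Filter α) : Algebra ℂ (l.Germ ℂ) :=
  Algebra.ofModule
    (fun r x y => by
      induction x using Filter.Germ.inductionOn
      induction y using Filter.Germ.inductionOn
      rw [← Germ.coe_smul, ← Germ.coe_mul, ← Germ.coe_mul, ← Germ.coe_smul, smul_mul_assoc])
    (fun r x y => by
      induction x using Filter.Germ.inductionOn
      induction y using Filter.Germ.inductionOn
      rw [← Germ.coe_smul, ← Germ.coe_mul, ← Germ.coe_mul, ← Germ.coe_smul, mul_smul_comm])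

/-- The ring of germs at the origin of holomorphic functions on `E`. For `E = ℂ × ℂ` this is
the ring `ℂ{x, y}` of convergent power series, for `E = ℂ` it is `ℂ{t}`. -/
def HolGerm (E : Type*) [NormedAddCommGroup E] [NormedSpace ℂ E] :
    Subalgebra ℂ ((𝓝 (0 : E)).Germ ℂ) where
  carrier := {g | ∃ h : E → ℂ, AnalyticAt ℂ h 0 ∧ (h : (𝓝 (0 : E)).Germ ℂ) = g}
  mul_mem' := by
    rintro _ _ ⟨a, ha, rfl⟩ ⟨b, hb, rfl⟩
    exact ⟨a * b, ha.mul hb, Germ.coe_mul a b⟩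
  add_mem' := by
    rintro _ _ ⟨a, ha, rfl⟩ ⟨b, hb, rfl⟩
    exact ⟨a + b, ha.add hb, Germ.coe_add a b⟩
  algebraMap_mem' r := by
    refine ⟨fun _ => r, analyticAt_const, ?_⟩
    rw [Algebra.algebraMap_eq_smul_one, ← Germ.coe_one, ← Germ.coe_smul]
    congr 1
    funext x
    simp

/-- The germ of a function that is holomorphic at the origin. -/
def HolGerm.mk {E : Type*} [NormedAddCommGroup E] [NormedSpace ℂ E] (h : E → ℂ)
    (hh : AnalyticAt ℂ h 0) : HolGerm E :=
  ⟨(h : (𝓝 (0 : E)).Germ ℂ), h, hh, rfl⟩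

/-- The order `ord_t` of a germ in one variable (it is `⊤` for the zero germ). -/
def HolGerm.ord (g : HolGerm ℂ) : ℕ∞ :=
  (g : (𝓝 (0 : ℂ)).Germ ℂ).liftOn (fun h => analyticOrderAt h 0)
    (fun _ _ h => analyticOrderAt_congr h)

/-! ### Irreducible plane curve singularities -/

/-- An irreducible plane curve singularity `(C, o) = ({F = 0}, 0) ⊂ (ℂ², 0)`, where `F` is an
irreducible element of `ℂ{x, y}`, together with a normalization (Puiseux parametrization)
`n : (ℂ, 0) → (C, o)`. A holomorphic map germ `(ℂ, 0) → (C, o)` to an irreducible curve germ is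
the normalization exactly if it is injective near `0`. -/
structure PlaneBranch where
  F : ℂ × ℂ → ℂ
  analyticAt_F : AnalyticAt ℂ F 0
  irreducible_F : Irreducible (HolGerm.mk F analyticAt_F)
  n : ℂ → ℂ × ℂ
  analyticAt_n : AnalyticAt ℂ n 0
  n_zero : n 0 = 0
  F_comp_n : ∀ᶠ t in 𝓝 (0 : ℂ), F (n t) = 0
  injective_n : ∃ V ∈ 𝓝 (0 : ℂ), Set.InjOn n V

namespace PlaneBranch

variable (C : PlaneBranch)

theorem tendsto_n : Tendsto C.n (𝓝 0) (𝓝 0) := by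
  have h := C.analyticAt_n.continuousAt.tendsto
  rwa [C.n_zero] at h

/-- Composition with the normalization, `ℂ{x, y} → ℂ{t}`, `h ↦ h ∘ n`. -/
def pullbackAmbient : HolGerm (ℂ × ℂ) →ₐ[ℂ] HolGerm ℂ where
  toFun h := ⟨(h : (𝓝 (0 : ℂ × ℂ)).Germ ℂ).compTendsto C.n C.tendsto_n, by
    obtain ⟨_, h, hh, rfl⟩ := h
    refine ⟨h ∘ C.n, ?_, (Germ.coe_compTendsto h C.tendsto_n).symm⟩
    exact AnalyticAt.comp (by rwa [C.n_zero]) C.analyticAt_n⟩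
  map_one' := rfl
  map_zero' := rfl
  map_mul' := by
    rintro ⟨_, a, ha, rfl⟩ ⟨_, b, hb, rfl⟩
    rfl
  map_add' := by
    rintro ⟨_, a, ha, rfl⟩ ⟨_, b, hb, rfl⟩
    rfl
  commutes' r := by
    apply Subtype.ext
    simp only [Algebra.algebraMap_eq_smul_one]
    rfl

/-- The equation of `C`, as an element of `ℂ{x, y}`. -/
def equation : HolGerm (ℂ × ℂ) := HolGerm.mk C.F C.analyticAt_F

/-- The local ring `𝒪_{C,o} = ℂ{x, y} / (F)`. -/
abbrev LocalRing : Type := HolGerm (ℂ × ℂ) ⧸ Ideal.span {C.equation}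

/-- The normalization map `n^* : 𝒪_{C,o} → ℂ{t}`. -/
def pullback : C.LocalRing →ₐ[ℂ] HolGerm ℂ :=
  Ideal.Quotient.liftₐ (Ideal.span {C.equation}) C.pullbackAmbient (by
    have h0 : C.pullbackAmbient C.equation = 0 := Subtype.ext (Germ.coe_eq.2 C.F_comp_n)
    intro a ha
    obtain ⟨b, rfl⟩ := Ideal.mem_span_singleton'.1 ha
    rw [map_mul, h0, mul_zero])

/-- The valuation `𝔳 : 𝒪_{C,o} → ℕ ∪ {∞}`, `f ↦ ord_t (n^* f)`. -/
def val (f : C.LocalRing) : ℕ∞ := HolGerm.ord (C.pullback f)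

/-- The semigroup of values `𝒮_{C,o}`. -/
def semigroup : Set ℕ := {k | ∃ f : C.LocalRing, C.val f = k}

/-- The delta invariant `δ(C, o) = #(ℕ ∖ 𝒮_{C,o})`. -/
def delta : ℕ := (C.semigroupᶜ).ncard

theorem exists_rep (f : C.LocalRing) :
    ∃ h : ℂ → ℂ, AnalyticAt ℂ h 0 ∧ ((C.pullback f : HolGerm ℂ) : (𝓝 (0 : ℂ)).Germ ℂ) = h :=
  let ⟨h, hh, e⟩ := (C.pullback f).2
  ⟨h, hh, e.symm⟩

theorem val_eq {f : C.LocalRing} {h : ℂ → ℂ}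
    (e : ((C.pullback f : HolGerm ℂ) : (𝓝 (0 : ℂ)).Germ ℂ) = h) :
    C.val f = analyticOrderAt h 0 := by
  unfold val HolGerm.ord
  rw [e]
  rfl

/-- The ideal `ℱ(ℓ) = {f ∈ 𝒪_{C,o} ∣ 𝔳(f) ≥ ℓ}`. -/
def filtration (l : ℕ) : Ideal C.LocalRing where
  carrier := {f | (l : ℕ∞) ≤ C.val f}
  zero_mem' := by
    have e : ((C.pullback 0 : HolGerm ℂ) : (𝓝 (0 : ℂ)).Germ ℂ) = ((0 : ℂ → ℂ) : Germ _ ℂ) := by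
      rw [map_zero]
      rfl
    have h : analyticOrderAt (0 : ℂ → ℂ) 0 = ⊤ :=
      analyticOrderAt_eq_top.2 (Eventually.of_forall fun _ => rfl)
    simp [C.val_eq e, h]
  add_mem' := by
    intro a b ha hb
    obtain ⟨f, -, ef⟩ := C.exists_rep a
    obtain ⟨g, -, eg⟩ := C.exists_rep b
    have e : ((C.pullback (a + b) : HolGerm ℂ) : (𝓝 (0 : ℂ)).Germ ℂ)
        = ((f + g : ℂ → ℂ) : Germ _ ℂ) := by
      rw [map_add, Germ.coe_add, ← ef, ← eg]
      rfl
    simp only [Set.mem_ofPred_eq, C.val_eq e, C.val_eq ef, C.val_eq eg] at *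
    exact (le_min ha hb).trans le_analyticOrderAt_add
  smul_mem' := by
    intro a b hb
    obtain ⟨f, hf, ef⟩ := C.exists_rep a
    obtain ⟨g, hg, eg⟩ := C.exists_rep b
    have e : ((C.pullback (a * b) : HolGerm ℂ) : (𝓝 (0 : ℂ)).Germ ℂ)
        = ((f * g : ℂ → ℂ) : Germ _ ℂ) := by
      rw [map_mul, Germ.coe_mul, ← ef, ← eg]
      rfl
    simp only [Set.mem_ofPred_eq, smul_eq_mul, C.val_eq e, C.val_eq eg] at *
    rw [analyticOrderAt_mul hf hg]
    exact hb.trans le_add_self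

/-- The Hilbert function `𝔥(ℓ) = dim_ℂ 𝒪_{C,o} / ℱ(ℓ)`. -/
def hilbert (l : ℕ) : ℕ := Module.finrank ℂ (C.LocalRing ⧸ C.filtration l)

/-- The weight function `w₀(ℓ) = 2 𝔥(ℓ) - ℓ`. -/
def weight (l : ℕ) : ℤ := 2 * (C.hilbert l : ℤ) - l

end PlaneBranch

/-! ### Lattice cohomology of a weight function on `ℕ` -/

namespace LatticeCohomology

variable (w : ℕ → ℤ)

/-- The sublevel set `S_n ⊂ ℝ_{≥ 0}` of the extended weight function
`x ↦ max (w ⌊x⌋) (w ⌈x⌉)`. -/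
def sublevel (n : ℤ) : Set ℝ := {x | 0 ≤ x ∧ max (w ⌊x⌋₊) (w ⌈x⌉₊) ≤ n}

theorem sublevel_mono {m n : ℤ} (h : m ≤ n) : sublevel w m ⊆ sublevel w n :=
  fun _ hx => ⟨hx.1, hx.2.trans h⟩

/-- `ℍ⁰_{2n} = H⁰(S_n, ℤ)`, the group of locally constant functions `S_n → ℤ`. -/
abbrev H0Piece (n : ℤ) : Type := LocallyConstant (sublevel w n) ℤ

/-- The restriction map `ℍ⁰_{2n} → ℍ⁰_{2n-2}` induced by the inclusion `S_{n-1} ⊆ S_n`. -/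
def restrict (n : ℤ) : H0Piece w n →ₗ[ℤ] H0Piece w (n - 1) :=
  LocallyConstant.comapₗ ℤ
    ⟨Set.inclusion (sublevel_mono w (sub_le_self n zero_le_one)), continuous_inclusion _⟩

/-- The `U`-action on `⨁ₙ ℍ⁰_{2n}`. -/
def U : Module.End ℤ (DirectSum ℤ (H0Piece w)) :=
  DirectSum.toModule ℤ ℤ _ fun n => DirectSum.lof ℤ ℤ (H0Piece w) (n - 1) ∘ₗ restrict w n

/-- `ℍ⁰ = ⨁ₙ ℍ⁰_{2n}` as a `ℤ[U]`-module; the variable `X` of `ℤ[X]` acts by `U`. -/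
abbrev H0 : Type := Module.AEval' (U w)

instance : AddCommGroup (H0 w) := Module.addCommMonoidToAddCommGroup ℤ

/-- The inclusion of the homogeneous part `ℍ⁰_{2n}` into `ℍ⁰`. -/
def incl (n : ℤ) (φ : H0Piece w n) : H0 w :=
  Module.AEval'.of (U w) (DirectSum.lof ℤ ℤ (H0Piece w) n φ)

/-- `𝕄_{≥ 2n}`, the `ℤ[U]`-submodule of `ℍ⁰` generated by `⨁_{k ≥ n} ℍ⁰_{2k}`. -/
def M (n : ℤ) : Submodule ℤ[X] (H0 w) :=
  Submodule.span ℤ[X] {x | ∃ k : ℤ, n ≤ k ∧ ∃ φ : H0Piece w k, incl w k φ = x}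

/-- The canonical submodule `T^∞_{2 min w}` of `ℍ⁰`, generated by `⨁_{k > 0} ℍ⁰_{2k}`. -/
def T : Submodule ℤ[X] (H0 w) :=
  Submodule.span ℤ[X] {x | ∃ k : ℤ, 0 < k ∧ ∃ φ : H0Piece w k, incl w k φ = x}

/-- The set `𝔑` of the integers `n ≥ min w` such that `U` acts trivially on
`𝕄_{≥ 2n} / T^∞_{2 min w}`. -/
def stable : Set ℤ :=
  {n | (∃ l, w l ≤ n) ∧ ∀ q : M w n ⧸ (T w).submoduleOf (M w n), (X : ℤ[X]) • q = 0}

end LatticeCohomology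

namespace PlaneBranch

variable (C : PlaneBranch)

/-- `e = min 𝔑`. -/
def e : ℤ := sInf (LatticeCohomology.stable C.weight)

/-- `ℰ_n = {s ∈ 𝒮_{C,o} ∣ w(s) ≥ n and s ≤ δ}`. -/
def initialPartAt (n : ℤ) : Set ℕ := {s | s ∈ C.semigroup ∧ n ≤ C.weight s ∧ s ≤ C.delta}

/-- The initial part `ℰ = ℰ_e` of the semigroup. -/
def initialPart : Set ℕ := C.initialPartAt C.e

/-- `β₀ < ⋯ < β_g` is the minimal generating set of the semigroup `𝒮_{C,o}`. -/
def IsMinimalGenerators (g : ℕ) (β : Fin (g + 1) → ℕ) : Prop :=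
  StrictMono β ∧
    Minimal (fun B : Set ℕ => (AddSubmonoid.closure B : Set ℕ) = C.semigroup) (Set.range β)

end PlaneBranch

end

noncomputable section

/-! ### Telescopic sequences and symmetric semigroups -/

/-! The semigroup of a plane branch is generated by a telescopic sequence: if `e` is the gcd of the
members so far and `b` the last of them, with `e'` the gcd before `b`, then the next member exceeds
`(e' / e) * b` and is not divisible by `e` (`PlaneBranch.exists_telescopic`). Adjoining such a
member preserves symmetry (`IsSymmetric.extend`), so the semigroup is symmetric with conductor `c =
2δ`. The Hilbert function counts the elements of the semigroup below `ℓ` (`PlaneBranch.hilbert_eq`).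
Hence the weight is a walk that rises by one at an element and falls by one at a gap, and it is
invariant under `ℓ ↦ c - ℓ` on `[0, c]`.

On the cohomological side, `U` is trivial on `𝕄_{≥ 2n} / T` as soon as, for every `k ≥ n`, no `z` of
weight above `k` lies between two points of weight at most `k - 1`: restriction from `S_k` to
`S_{k-1}` then produces only constants, and these lie in `T` (`LatticeCohomology.mem_stable`). As
`e` is the least stable integer, `e ≤ w(x)` follows once every peak rising by at least two on both
sides has height at most `w(x)`. This is `Telescopic.weight_le_of_peak` for all generators `x` but
the last.

For the peak bound, let `b` be the last generator and `d ≥ 2` the gcd of the others. Up to `b` the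
semigroup contains only multiples of `d`, so the walk never climbs by two; by symmetry a peak lies
in `b < z < c - b`, and one may take `z ≤ c / 2`. There the elements below `z` split into those
generated without `b` and a translate by `b` of those below `z - b`. This recursion reduces the
comparison with the weight at the last generator but one to the inequality `weight_estimate`.

Telescopic generation comes from division by monic polynomials in `y` of suitable degrees
(`IsCurveValuation.exists_telescopic`). That the final gcd is `1` expresses injectivity of the
parametrization (`PlaneBranch.ord_ne_add`). The second claim follows because the smallest generator
is positive and would lie in the initial part. -/

/-- `G` is the set of members of a telescopic sequence starting with `m`; `e` is its greatest
common divisor, `f` the largest multiple of `e` outside the generated semigroup, and `t` is the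
bound which the next member has to exceed. -/
inductive Telescopic (m : ℕ) : Set ℕ → ℕ → ℤ → ℕ → Prop
  | base : Telescopic m {m} m (-m) m
  | step {G : Set ℕ} {e : ℕ} {f : ℤ} {t : ℕ} (b : ℕ) (h : Telescopic m G e f t) (htb : t < b)
      (heb : ¬ e ∣ b) :
      Telescopic m (insert b G) (e.gcd b) (f + ((e / e.gcd b : ℕ) - 1 : ℤ) * b)
        (e / e.gcd b * b)

/-- `A` is symmetric as a subset of `e ℕ`, with Frobenius number `f`. -/
def IsSymmetric (A : AddSubmonoid ℕ) (e : ℕ) (f : ℤ) : Prop :=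
  ∀ k : ℤ, (e : ℤ) ∣ k → ((∃ a ∈ A, (a : ℤ) = k) ↔ ¬ ∃ a ∈ A, (a : ℤ) = f - k)

theorem IsSymmetric.mem_of_lt {A : AddSubmonoid ℕ} {e : ℕ} {f : ℤ} (h : IsSymmetric A e f)
    {k : ℕ} (hk : e ∣ k) (hf : f < k) : k ∈ A := by
  obtain ⟨a, ha, hak⟩ := (h k (Int.natCast_dvd_natCast.2 hk)).2 (by rintro ⟨a, -, ha⟩; omega)
  rwa [← Nat.cast_injective hak]

theorem IsSymmetric.neg_le {A : AddSubmonoid ℕ} {e : ℕ} {f : ℤ} (h : IsSymmetric A e f)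
    (he : 0 < e) (hf : (e : ℤ) ∣ f) : -(e : ℤ) ≤ f := by
  by_contra! hlt
  obtain ⟨a, ha, hak⟩ := (h (f + e) (by simpa using hf)).2 (by rintro ⟨a, -, ha⟩; omega)
  omega

theorem Nat.Coprime.exists_lt_dvd_sub_mul {n b : ℕ} (h : n.Coprime b) (hn : 0 < n) (k : ℤ) :
    ∃ j : ℕ, j < n ∧ (n : ℤ) ∣ k - j * b := by
  have hb := Nat.gcd_eq_gcd_ab n b
  rw [h.gcd_eq_one] at hb
  have hn' : (0 : ℤ) < n := by exact_mod_cast hn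
  refine ⟨(n.gcdB b * k % n).toNat, ?_, ?_⟩
  · have := Int.emod_lt_of_pos (n.gcdB b * k) hn'
    omega
  · rw [Int.toNat_of_nonneg (Int.emod_nonneg _ hn'.ne'), Int.emod_def]
    refine ⟨n.gcdA b * k + b * (n.gcdB b * k / n), ?_⟩
    push_cast at hb
    linear_combination k * hb

section Extension

variable {A : AddSubmonoid ℕ} {g n b : ℕ}

theorem mem_sup_closure_singleton_iff (hn : 0 < n) (hmem : n * b ∈ A) {x : ℕ} :
    x ∈ A ⊔ AddSubmonoid.closure {b} ↔ ∃ j < n, ∃ a ∈ A, j * b + a = x := by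
  rw [AddSubmonoid.mem_sup]
  simp only [AddSubmonoid.mem_closure_singleton]
  constructor
  · rintro ⟨a, ha, _, ⟨k, rfl⟩, rfl⟩
    refine ⟨k % n, Nat.mod_lt _ hn, a + (k / n) • (n * b), A.add_mem ha (A.nsmul_mem hmem _), ?_⟩
    conv_rhs => rw [← Nat.mod_add_div k n]
    simp only [smul_eq_mul]
    ring
  · rintro ⟨j, -, a, ha, rfl⟩
    exact ⟨a, ha, j * b, ⟨j, by simp⟩, add_comm _ _⟩

theorem eq_of_mul_add_eq_mul_add (hg : 0 < g) (hcop : n.Coprime b) (hA : ∀ a ∈ A, n * g ∣ a)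
    {i j a a' : ℕ} (hi : i < n) (hj : j < n) (ha : a ∈ A) (ha' : a' ∈ A)
    (h : i * (b * g) + a = j * (b * g) + a') : i = j := by
  obtain ⟨u, rfl⟩ := hA _ ha
  obtain ⟨u', rfl⟩ := hA _ ha'
  have h1 : i * b + n * u = j * b + n * u' := by
    apply Nat.eq_of_mul_eq_mul_right hg
    linarith
  have h2 : i * b ≡ j * b [MOD n] := by
    have := congrArg (· % n) h1
    simpa [Nat.ModEq, Nat.add_mod] using this
  exact (Nat.ModEq.cancel_right_of_coprime hcop h2).eq_of_lt_of_lt hi hj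

/-- Every multiple `k` of `g` has a unique index `j < n` with `k - j * (b * g)` divisible by `n *
g`, and `k` lies in the larger semigroup exactly when this difference lies in `A`. The mirror image
of `k` has index `n - 1 - j`, and its difference is the mirror image under `f` of that of `k`. -/
theorem IsSymmetric.extend {f : ℤ} (hs : IsSymmetric A (n * g) f) (hn : 0 < n) (hg : 0 < g)
    (hcop : n.Coprime b) (hA : ∀ a ∈ A, n * g ∣ a) (hf : ((n * g : ℕ) : ℤ) ∣ f)
    (hmem : n * (b * g) ∈ A) :
    IsSymmetric (A ⊔ AddSubmonoid.closure {b * g}) g (f + ((n : ℤ) - 1) * (b * g : ℕ)) := by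
  have key : ∀ (k : ℤ) (j : ℕ), j < n → ((n * g : ℕ) : ℤ) ∣ k - j * (b * g : ℕ) →
      ((∃ a ∈ A ⊔ AddSubmonoid.closure {b * g}, (a : ℤ) = k) ↔
        ∃ a ∈ A, (a : ℤ) = k - j * (b * g : ℕ)) := by
    intro k j hj hdvd
    constructor
    · rintro ⟨x, hx, rfl⟩
      obtain ⟨i, hi, a, ha, rfl⟩ := (mem_sup_closure_singleton_iff hn hmem).1 hx
      have hij : i = j := by
        obtain ⟨u, rfl⟩ := hA _ ha
        obtain ⟨w, hw⟩ := hdvd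
        have hg' : (g : ℤ) ≠ 0 := by exact_mod_cast hg.ne'
        have h1 : (n : ℤ) ∣ (i - j) * b := by
          refine ⟨w - u, mul_right_cancel₀ hg' ?_⟩
          push_cast at hw
          linear_combination hw
        have h2 : (n : ℤ) ∣ i - j :=
          IsCoprime.dvd_of_dvd_mul_right (Nat.isCoprime_iff_coprime.2 hcop) h1
        have h3 := Int.eq_zero_of_abs_lt_dvd h2 (by rw [abs_lt]; omega)
        omega
      subst hij
      exact ⟨a, ha, by push_cast; ring⟩
    · rintro ⟨a, ha, hak⟩
      exact ⟨j * (b * g) + a, (mem_sup_closure_singleton_iff hn hmem).2 ⟨j, hj, a, ha, rfl⟩,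
        by push_cast at hak ⊢; linear_combination hak⟩
  rintro k ⟨k', rfl⟩
  obtain ⟨j, hj, w, hw⟩ := hcop.exists_lt_dvd_sub_mul hn k'
  have hd : ((n * g : ℕ) : ℤ) ∣ g * k' - j * (b * g : ℕ) :=
    ⟨w, by push_cast; linear_combination g * hw⟩
  have hd2 : ((n * g : ℕ) : ℤ) ∣
      f + ((n : ℤ) - 1) * (b * g : ℕ) - g * k' - (n - 1 - j : ℕ) * (b * g : ℕ) := by
    have : f + ((n : ℤ) - 1) * (b * g : ℕ) - g * k' - (n - 1 - j : ℕ) * (b * g : ℕ)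
        = f - (g * k' - j * (b * g : ℕ)) := by
      rw [Nat.sub_sub, Nat.cast_sub (by omega)]
      push_cast
      ring
    rw [this]
    exact dvd_sub hf hd
  rw [key _ j hj hd, key _ (n - 1 - j) (by omega) hd2, hs _ hd]
  have : f + ((n : ℤ) - 1) * (b * g : ℕ) - g * k' - (n - 1 - j : ℕ) * (b * g : ℕ)
      = f - (g * k' - j * (b * g : ℕ)) := by
    rw [Nat.sub_sub, Nat.cast_sub (by omega)]
    push_cast
    ring
  rw [this]

end Extension

namespace Telescopic

variable {m : ℕ} {G : Set ℕ} {e : ℕ} {f : ℤ} {t : ℕ}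

theorem mem (h : Telescopic m G e f t) : m ∈ G := by
  induction h with
  | base => exact rfl
  | step b h _ _ ih => exact Or.inr ih

theorem pos (h : Telescopic m G e f t) (hm : 0 < m) : 0 < e := by
  induction h with
  | base => exact hm
  | step b h _ _ ih => exact Nat.gcd_pos_of_pos_left _ ih

theorem dvd (h : Telescopic m G e f t) : ∀ x ∈ G, e ∣ x := by
  induction h with
  | base => simp
  | step b h _ _ ih =>
    rintro x (rfl | hx)
    · exact Nat.gcd_dvd_right _ _
    · exact (Nat.gcd_dvd_left _ _).trans (ih x hx)

theorem dvd_of_mem_closure (h : Telescopic m G e f t) {x : ℕ} (hx : x ∈ AddSubmonoid.closure G) :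
    e ∣ x := by
  induction hx using AddSubmonoid.closure_induction with
  | mem x hx => exact h.dvd x hx
  | zero => exact dvd_zero e
  | add x y _ _ h1 h2 => exact dvd_add h1 h2

theorem dvd_frobenius (h : Telescopic m G e f t) : (e : ℤ) ∣ f := by
  induction h with
  | base => simp
  | @step G e f t b h _ _ ih =>
    refine dvd_add (dvd_trans ?_ ih) (dvd_mul_of_dvd_right ?_ _)
    · exact Int.natCast_dvd_natCast.2 (Nat.gcd_dvd_left e b)
    · exact Int.natCast_dvd_natCast.2 (Nat.gcd_dvd_right e b)

theorem dvd_bound (h : Telescopic m G e f t) : e ∣ t := by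
  induction h with
  | base => simp
  | step b h _ _ ih => exact dvd_mul_of_dvd_right (Nat.gcd_dvd_right _ _) _

/-- Since `t < b`, a step raises the left side by `(n - 1) * b` and the bound by `n * b - t`, which
is more. Thus every multiple of `e` from `t` on lies in the semigroup. -/
theorem frobenius_le (h : Telescopic m G e f t) : f ≤ t - 2 * m := by
  induction h with
  | base => omega
  | step b h _ _ ih =>
    push_cast
    linarith

theorem one_lt_div (h : Telescopic m G e f t) (hm : 0 < m) {b : ℕ} (heb : ¬ e ∣ b) :
    1 < e / e.gcd b := by
  have he := h.pos hm
  have hg := Nat.gcd_pos_of_pos_left b he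
  obtain ⟨q, hq⟩ := Nat.gcd_dvd_left e b
  rw [show e / e.gcd b = q from Nat.div_eq_of_eq_mul_right hg hq]
  by_contra! hle
  interval_cases q
  · omega
  · exact heb (by rw [hq, mul_one]; exact Nat.gcd_dvd_right e b)

theorem pos_of_mem (h : Telescopic m G e f t) (hm : 0 < m) : ∀ x ∈ G, 0 < x := by
  induction h with
  | base => simpa
  | step b h htb _ ih =>
    rintro x (rfl | hx)
    · omega
    · exact ih x hx

theorem le_bound (h : Telescopic m G e f t) (hm : 0 < m) : ∀ x ∈ G, x ≤ t := by
  induction h with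
  | base => simp
  | step b h htb heb ih =>
    have h1 := h.one_lt_div hm heb
    rintro x (rfl | hx)
    · nlinarith
    · nlinarith [ih x hx]

theorem closure_insert {b : ℕ} :
    AddSubmonoid.closure (insert b G) = AddSubmonoid.closure G ⊔ AddSubmonoid.closure {b} := by
  rw [Set.insert_eq, AddSubmonoid.closure_union, sup_comm]

theorem isSymmetric (h : Telescopic m G e f t) (hm : 0 < m) :
    IsSymmetric (AddSubmonoid.closure G) e f := by
  induction h with
  | base =>
    rintro k ⟨q, rfl⟩
    simp only [AddSubmonoid.mem_closure_singleton]
    have hm' : (0 : ℤ) < m := by exact_mod_cast hm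
    constructor
    · rintro ⟨_, ⟨a, rfl⟩, ha⟩ ⟨_, ⟨a', rfl⟩, ha'⟩
      simp only [smul_eq_mul, Nat.cast_mul] at ha ha'
      nlinarith
    · intro hne
      have hq : 0 ≤ q := by
        by_contra! hq
        refine hne ⟨(-1 - q).toNat * m, ⟨_, rfl⟩, ?_⟩
        rw [Nat.cast_mul, Int.toNat_of_nonneg (by omega)]
        ring
      exact ⟨q.toNat * m, ⟨_, rfl⟩, by rw [Nat.cast_mul, Int.toNat_of_nonneg hq]; ring⟩
  | @step G e f t b h htb heb ih =>
    have he := h.pos hm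
    obtain ⟨g, n, b', hg, hcop, h1, h2⟩ := Nat.exists_coprime' (Nat.gcd_pos_of_pos_left b he)
    have hgcd : e.gcd b = g := by rw [h1, h2, Nat.gcd_mul_right, hcop.gcd_eq_one, one_mul]
    have hdiv : e / g = n := by rw [h1, Nat.mul_div_cancel _ hg]
    have hn : 1 < n := by simpa [hgcd, hdiv] using h.one_lt_div hm heb
    have hfb := h.frobenius_le
    rw [closure_insert, hgcd, hdiv]
    subst h1 h2
    refine ih.extend (by omega) hg hcop (fun a ha => h.dvd_of_mem_closure ha) h.dvd_frobenius ?_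
    refine ih.mem_of_lt ⟨b', by ring⟩ ?_
    have : b' * g ≤ n * (b' * g) := Nat.le_mul_of_pos_left _ (by omega)
    have h3 : ((b' * g : ℕ) : ℤ) ≤ (n * (b' * g) : ℕ) := by exact_mod_cast this
    omega

/-- The product is the lcm of `e` and `b`, a multiple of `e` beyond the Frobenius number. -/
theorem mul_mem_closure (h : Telescopic m G e f t) (hm : 0 < m) {b : ℕ} (htb : t < b)
    (heb : ¬ e ∣ b) : e / e.gcd b * b ∈ AddSubmonoid.closure G := by
  refine (h.isSymmetric hm).mem_of_lt ?_ ?_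
  · rw [Nat.div_mul_right_comm (Nat.gcd_dvd_left e b), Nat.mul_div_assoc _ (Nat.gcd_dvd_right e b)]
    exact dvd_mul_right _ _
  · have h1 := h.one_lt_div hm heb
    have h2 := h.frobenius_le
    have h3 : b ≤ e / e.gcd b * b := Nat.le_mul_of_pos_left _ (by omega)
    zify at h3
    push_cast
    omega

theorem mem_closure_insert_iff (h : Telescopic m G e f t) (hm : 0 < m) {b : ℕ} (htb : t < b)
    (heb : ¬ e ∣ b) {x : ℕ} : x ∈ AddSubmonoid.closure (insert b G) ↔
      ∃ j < e / e.gcd b, ∃ a ∈ AddSubmonoid.closure G, j * b + a = x := by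
  have h1 := h.one_lt_div hm heb
  rw [closure_insert, mem_sup_closure_singleton_iff (by omega) (h.mul_mem_closure hm htb heb)]

theorem eq_of_mul_add_eq (h : Telescopic m G e f t) (hm : 0 < m) {b : ℕ} {i j a a' : ℕ}
    (hi : i < e / e.gcd b) (hj : j < e / e.gcd b) (ha : a ∈ AddSubmonoid.closure G)
    (ha' : a' ∈ AddSubmonoid.closure G) (hij : i * b + a = j * b + a') : i = j := by
  have he := h.pos hm
  obtain ⟨g, n, b', hg, hcop, h1, h2⟩ := Nat.exists_coprime' (Nat.gcd_pos_of_pos_left b he)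
  have hgcd : e.gcd b = g := by rw [h1, h2, Nat.gcd_mul_right, hcop.gcd_eq_one, one_mul]
  have hdiv : e / g = n := by rw [h1, Nat.mul_div_cancel _ hg]
  rw [hgcd, hdiv] at hi hj
  subst h1 h2
  exact eq_of_mul_add_eq_mul_add hg hcop (fun a ha => h.dvd_of_mem_closure ha) hi hj ha ha' hij

theorem mem_closure_of_lt (h : Telescopic m G e f t) (hm : 0 < m) {b : ℕ} (htb : t < b)
    (heb : ¬ e ∣ b) {x : ℕ} (hx : x ∈ AddSubmonoid.closure (insert b G)) (hxb : x < b) :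
    x ∈ AddSubmonoid.closure G := by
  obtain ⟨j, -, a, ha, rfl⟩ := (h.mem_closure_insert_iff hm htb heb).1 hx
  rcases j.eq_zero_or_pos with rfl | hj
  · simpa using ha
  · nlinarith

/-- The members of a telescopic sequence are indecomposable in the semigroup they generate. -/
theorem eq_zero_or_eq_zero_of_add_mem (h : Telescopic m G e f t) (hm : 0 < m) :
    ∀ u ∈ AddSubmonoid.closure G, ∀ v ∈ AddSubmonoid.closure G, u + v ∈ G → u = 0 ∨ v = 0 := by
  induction h with
  | base =>
    simp only [AddSubmonoid.mem_closure_singleton]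
    rintro _ ⟨a, rfl⟩ _ ⟨b, rfl⟩ hab
    have h1 : (a + b) * m = 1 * m := by
      rw [one_mul, add_mul]
      exact hab
    have h2 := Nat.eq_of_mul_eq_mul_right hm h1
    rcases (by omega : a = 0 ∨ b = 0) with rfl | rfl <;> simp
  | @step G e f t b h htb heb ih =>
    intro u hu v hv huv
    by_cases hu0 : u = 0
    · exact Or.inl hu0
    by_cases hv0 : v = 0
    · exact Or.inr hv0
    -- Both summands are then below `b`, hence in the old semigroup, all of whose elements are
    -- divisible by `e`; so the sum cannot be `b`.
    have hle : u + v ≤ b := by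
      rcases huv with huv | huv
      · exact huv.le
      · exact (h.le_bound hm _ huv).trans htb.le
    have hu' := h.mem_closure_of_lt hm htb heb hu (by omega)
    have hv' := h.mem_closure_of_lt hm htb heb hv (by omega)
    rcases huv with huv | huv
    · exact (heb (huv ▸ h.dvd_of_mem_closure (add_mem hu' hv'))).elim
    · exact ih u hu' v hv' huv

/-- A telescopic sequence is contained in every generating set of its semigroup. -/
theorem subset_of_closure_eq (h : Telescopic m G e f t) (hm : 0 < m) {B : Set ℕ}
    (hB : AddSubmonoid.closure B = AddSubmonoid.closure G) : G ⊆ B := by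
  intro x hx
  have key : ∀ y ∈ AddSubmonoid.closure B, y ∈ G → y ∈ B := by
    intro y hy
    induction hy using AddSubmonoid.closure_induction with
    | mem y hy => exact fun _ => hy
    | zero => exact fun h0 => absurd (h.pos_of_mem hm 0 h0) (lt_irrefl 0)
    | add u v hu hv h1 h2 =>
      intro huv
      rcases h.eq_zero_or_eq_zero_of_add_mem hm u (hB ▸ hu) v (hB ▸ hv) huv with rfl | rfl
      · simpa using h2 (by simpa using huv)
      · simpa using h1 (by simpa using huv)
  exact key x (hB ▸ AddSubmonoid.subset_closure hx) hx

end Telescopic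

/-! ### The weight function of a numerical semigroup -/

open Classical in
/-- The number of elements of `S` below `l`. -/
def countBelow (S : Set ℕ) (l : ℕ) : ℕ := Nat.count (· ∈ S) l

/-- The weight function of `S`: the number of elements below `l` minus the number of gaps. -/
def semigroupWeight (S : Set ℕ) (l : ℕ) : ℤ := 2 * (countBelow S l : ℤ) - l

section Weight

variable {S : Set ℕ}

theorem countBelow_zero : countBelow S 0 = 0 := by
  classical
  exact Nat.count_zero _

theorem countBelow_succ_of_mem {l : ℕ} (h : l ∈ S) : countBelow S (l + 1) = countBelow S l + 1 := by
  classical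
  simp [countBelow, Nat.count_succ, h]

theorem countBelow_succ_of_notMem {l : ℕ} (h : l ∉ S) : countBelow S (l + 1) = countBelow S l := by
  classical
  simp [countBelow, Nat.count_succ, h]

theorem countBelow_mono : Monotone (countBelow S) := by
  classical
  exact Nat.count_monotone _

theorem countBelow_congr {S' : Set ℕ} {l : ℕ} (h : ∀ k < l, k ∈ S ↔ k ∈ S') :
    countBelow S l = countBelow S' l := by
  induction l with
  | zero => rfl
  | succ l ih =>
    have ih := ih fun k hk => h k (by omega)
    by_cases hl : l ∈ S
    · rw [countBelow_succ_of_mem hl, countBelow_succ_of_mem ((h l (by omega)).1 hl), ih]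
    · rw [countBelow_succ_of_notMem hl,
        countBelow_succ_of_notMem (fun h' => hl ((h l (by omega)).2 h')), ih]

theorem semigroupWeight_zero : semigroupWeight S 0 = 0 := by
  simp [semigroupWeight, countBelow_zero]

theorem semigroupWeight_succ_of_mem {l : ℕ} (h : l ∈ S) :
    semigroupWeight S (l + 1) = semigroupWeight S l + 1 := by
  rw [semigroupWeight, semigroupWeight, countBelow_succ_of_mem h]
  push_cast
  ring

theorem semigroupWeight_succ_of_notMem {l : ℕ} (h : l ∉ S) :
    semigroupWeight S (l + 1) = semigroupWeight S l - 1 := by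
  rw [semigroupWeight, semigroupWeight, countBelow_succ_of_notMem h]
  push_cast
  ring

theorem two_mul_countBelow (l : ℕ) : 2 * (countBelow S l : ℤ) = semigroupWeight S l + l := by
  rw [semigroupWeight]
  ring

end Weight

section Semigroup

variable {S : AddSubmonoid ℕ}

/-- For a gap `l`, the map `x ↦ l - x` sends elements of the semigroup to gaps, so at most half of
`0, …, l` are elements. -/
theorem semigroupWeight_le_one_of_notMem {l : ℕ} (hl : l ∉ S) :
    semigroupWeight S l ≤ 1 := by
  classical
  suffices h : 2 * countBelow S (l + 1) ≤ l + 1 by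
    rw [countBelow_succ_of_notMem hl] at h
    rw [semigroupWeight]
    omega
  rw [countBelow, Nat.count_eq_card_filter_range]
  set F := (Finset.range (l + 1)).filter (· ∈ (S : Set ℕ))
  have hinj : Set.InjOn (fun x => l - x) (F : Set ℕ) := by
    intro x hx y hy hxy
    simp only [F, Finset.coe_filter, Finset.mem_range, Set.mem_ofPred_eq] at hx hy hxy
    omega
  have hdisj : Disjoint F (F.image fun x => l - x) := by
    rw [Finset.disjoint_left]
    intro x hx hx'
    obtain ⟨y, hy, rfl⟩ := Finset.mem_image.1 hx'
    simp only [F, Finset.mem_filter, Finset.mem_range, SetLike.mem_coe] at hx hy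
    apply hl
    have := S.add_mem hx.2 hy.2
    rwa [Nat.sub_add_cancel (by omega)] at this
  have hsub : F ∪ F.image (fun x => l - x) ⊆ Finset.range (l + 1) := by
    intro x hx
    rcases Finset.mem_union.1 hx with hx | hx
    · exact (Finset.mem_filter.1 hx).1
    · obtain ⟨y, hy, rfl⟩ := Finset.mem_image.1 hx
      exact Finset.mem_range.2 (by omega)
  have := Finset.card_le_card hsub
  rw [Finset.card_union_of_disjoint hdisj, Finset.card_image_of_injOn hinj,
    Finset.card_range] at this
  omega

/-- Descending from `c`: gaps are covered by the pairing argument, and at an element of the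
semigroup the weight is one less than at its successor. -/
theorem semigroupWeight_le_one {c l : ℕ} (hc : semigroupWeight S c ≤ 1) (hl : l ≤ c) :
    semigroupWeight S l ≤ 1 := by
  refine Nat.decreasingInduction (motive := fun l _ => semigroupWeight S l ≤ 1)
    (fun l _ ih => ?_) hc hl
  by_cases h : l ∈ S
  · rw [semigroupWeight_succ_of_mem h] at ih
    omega
  · exact semigroupWeight_le_one_of_notMem h

namespace IsSymmetric

variable {c : ℕ}

theorem mem_iff (h : IsSymmetric S 1 (c - 1)) {k : ℕ} (hk : k < c) : k ∈ S ↔ c - 1 - k ∉ S := by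
  have := h k (by simp)
  constructor
  · intro hkS hcS
    refine this.1 ⟨k, hkS, rfl⟩ ⟨_, hcS, by omega⟩
  · intro hcS
    obtain ⟨a, ha, hak⟩ := this.2 (by
      rintro ⟨a, ha, hak⟩
      apply hcS
      rwa [show c - 1 - k = a by omega])
    rwa [← Nat.cast_injective hak]

theorem mem_of_le (h : IsSymmetric S 1 (c - 1)) {k : ℕ} (hk : c ≤ k) : k ∈ S :=
  h.mem_of_lt (one_dvd k) (by omega)

theorem weight_sub (h : IsSymmetric S 1 (c - 1)) {l : ℕ} (hl : l ≤ c) :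
    semigroupWeight S (c - l) = semigroupWeight S l := by
  have key : ∀ k ≤ c, semigroupWeight S (c - k) - semigroupWeight S k = semigroupWeight S c := by
    intro k hk
    induction k with
    | zero => simp [semigroupWeight_zero]
    | succ k ih =>
      have ih := ih (by omega)
      have hs : c - k = c - 1 - k + 1 := by omega
      rw [hs] at ih
      rw [show c - (k + 1) = c - 1 - k by omega]
      by_cases hkS : k ∈ S
      · rw [semigroupWeight_succ_of_notMem ((h.mem_iff (by omega)).1 hkS)] at ih
        rw [semigroupWeight_succ_of_mem hkS]
        omega
      · have : c - 1 - k ∈ S := by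
          by_contra h'
          exact hkS ((h.mem_iff (by omega)).2 h')
        rw [semigroupWeight_succ_of_mem this] at ih
        rw [semigroupWeight_succ_of_notMem hkS]
        omega
  -- The case `k = c` of `key` gives `-w(c) = w(c)`, so the constant difference vanishes.
  have h1 := key l hl
  have h2 := key c le_rfl
  rw [Nat.sub_self, semigroupWeight_zero] at h2
  omega

theorem weight_conductor (h : IsSymmetric S 1 (c - 1)) : semigroupWeight S c = 0 := by
  rw [← h.weight_sub le_rfl, Nat.sub_self, semigroupWeight_zero]

theorem weight_of_le (h : IsSymmetric S 1 (c - 1)) {l : ℕ} (hl : c ≤ l) :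
    semigroupWeight S l = l - c := by
  induction l, hl using Nat.le_induction with
  | base => rw [h.weight_conductor, sub_self]
  | succ l hl ih =>
    rw [semigroupWeight_succ_of_mem (h.mem_of_le hl), ih]
    push_cast
    ring

theorem weight_le (h : IsSymmetric S 1 (c - 1)) {l : ℕ} (hl : l ≤ c) :
    semigroupWeight S l ≤ 1 :=
  semigroupWeight_le_one (by rw [h.weight_conductor]; norm_num) hl

theorem weight_le_max (h : IsSymmetric S 1 (c - 1)) (l : ℕ) :
    semigroupWeight S l ≤ max 1 ((l : ℤ) - c) := by
  rcases le_total l c with hl | hl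
  · exact (h.weight_le hl).trans (le_max_left _ _)
  · exact (h.weight_of_le hl).le.trans (le_max_right _ _)

theorem two_mul_ncard_compl (h : IsSymmetric S 1 (c - 1)) :
    2 * (S : Set ℕ)ᶜ.ncard = c := by
  classical
  have h1 : (S : Set ℕ)ᶜ = ((Finset.range c).filter (fun k => ¬ k ∈ (S : Set ℕ)) : Finset ℕ) := by
    ext k
    simp only [Set.mem_compl_iff, SetLike.mem_coe, Finset.coe_filter, Finset.mem_range,
      Set.mem_ofPred_eq]
    refine ⟨fun hk => ⟨?_, hk⟩, fun hk => hk.2⟩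
    by_contra! hc
    exact hk (h.mem_of_le hc)
  have h2 := h.weight_conductor
  have h3 := Finset.card_filter_add_card_filter_not (s := Finset.range c) (· ∈ (S : Set ℕ))
  rw [semigroupWeight, countBelow, Nat.count_eq_card_filter_range] at h2
  rw [h1, Set.ncard_coe_finset]
  rw [Finset.card_range] at h3
  omega

end IsSymmetric

end Semigroup

/-! ### Rescaling -/

/-- The semigroup of the `k` such that `d * k ∈ A`. -/
def rescale (d : ℕ) (A : AddSubmonoid ℕ) : AddSubmonoid ℕ :=
  A.comap (AddMonoidHom.mulLeft d)

theorem mem_rescale {d : ℕ} {A : AddSubmonoid ℕ} {k : ℕ} : k ∈ rescale d A ↔ d * k ∈ A := Iff.rfl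

theorem IsSymmetric.rescale {A : AddSubmonoid ℕ} {d : ℕ} {f : ℤ} (hd : 0 < d)
    (hA : ∀ a ∈ A, d ∣ a) (h : IsSymmetric A d (d * f)) :
    IsSymmetric (rescale d A) 1 f := by
  have hd' : (d : ℤ) ≠ 0 := by exact_mod_cast hd.ne'
  have key : ∀ k : ℤ, (∃ a ∈ _root_.rescale d A, (a : ℤ) = k) ↔ ∃ a ∈ A, (a : ℤ) = d * k := by
    intro k
    constructor
    · rintro ⟨a, ha, rfl⟩
      exact ⟨_, ha, by push_cast; rfl⟩
    · rintro ⟨a, ha, hak⟩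
      obtain ⟨u, rfl⟩ := hA a ha
      refine ⟨u, ha, mul_left_cancel₀ hd' ?_⟩
      exact_mod_cast hak
  intro k _
  rw [key, key, h _ (dvd_mul_right _ _), mul_sub]

/-- The multiples of `d` below `z` are the `d * k` with `k < ⌈z / d⌉`, and `(z + d - 1) / d` is this
ceiling. -/
theorem countBelow_eq_rescale {A : AddSubmonoid ℕ} {d : ℕ} (hd : 0 < d)
    (hA : ∀ a ∈ A, d ∣ a) (z : ℕ) : countBelow A z = countBelow (rescale d A) ((z + d - 1) / d) := by
  induction z with
  | zero =>
    rw [show (0 + d - 1) / d = 0 from Nat.div_eq_of_lt (by omega)]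
    rfl
  | succ z ih =>
    by_cases hdz : d ∣ z
    · obtain ⟨u, rfl⟩ := hdz
      have h1 : (d * u + 1 + d - 1) / d = u + 1 := by
        rw [show d * u + 1 + d - 1 = d * (u + 1) by rw [Nat.mul_succ]; omega,
          Nat.mul_div_cancel_left _ hd]
      have h2 : (d * u + d - 1) / d = u := by
        rw [show d * u + d - 1 = (d - 1) + d * u by omega, Nat.add_mul_div_left _ _ hd,
          Nat.div_eq_of_lt (by omega), zero_add]
      rw [h1]
      rw [h2] at ih
      by_cases hu : d * u ∈ A
      · rw [countBelow_succ_of_mem hu, countBelow_succ_of_mem (l := u) hu, ih]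
      · rw [countBelow_succ_of_notMem hu, countBelow_succ_of_notMem (l := u) hu, ih]
    · rw [countBelow_succ_of_notMem (fun h => hdz (hA z h)), ih]
      congr 1
      rw [show z + 1 + d - 1 = z + d - 1 + 1 by omega, Nat.succ_div_of_not_dvd]
      rwa [show z + d - 1 + 1 = z + d by omega, Nat.dvd_add_self_right]

theorem countBelow_add_le {S : Set ℕ} (l k : ℕ) : countBelow S (l + k) ≤ countBelow S l + k := by
  induction k with
  | zero => simp
  | succ k ih =>
    by_cases h : l + k ∈ S
    · rw [← add_assoc, countBelow_succ_of_mem h]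
      omega
    · rw [← add_assoc, countBelow_succ_of_notMem h]
      omega

theorem countBelow_lt {S : Set ℕ} {k l : ℕ} (hk : k ∈ S) (hkl : k < l) :
    countBelow S k < countBelow S l := by
  have h1 := countBelow_succ_of_mem hk
  have h2 := countBelow_mono (S := S) (show k + 1 ≤ l from hkl)
  omega

/-! ### Weights on both sides of the last generator -/

/-- The estimate behind the comparison of the weights beyond and before the last generator. -/
theorem weight_estimate {d n B b y Y Z c H W : ℤ} (hd : 3 ≤ d) (hn : 2 ≤ n) (hB : 3 ≤ B)
    (hb : n * (d * B) + 1 ≤ b) (hy : 1 ≤ y) (hY : d * Y ≤ y + d - 1) (hZ : d * Z ≤ b + y + d - 1)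
    (hc : (n - 1) * (B - 1) ≤ c) (hH : 2 ≤ H) (hW : W ≤ max 1 (Y - c))
    (h3 : d = 3 → Y ≤ c) (hYge : y ≤ d * Y) :
    Z - c + Z + (W + Y) - (b + y) ≤ 2 * H - d * B := by
  have hc2 : 2 ≤ c := by nlinarith
  obtain ⟨r, rfl⟩ : ∃ r, b = n * (d * B) + r := ⟨b - n * (d * B), by ring⟩
  obtain ⟨X, rfl⟩ : ∃ X, Z = n * B + X := ⟨Z - n * B, by ring⟩
  have hX : d * X ≤ r + y + d - 1 := by linarith
  have hr : 1 ≤ r := by linarith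
  -- The inequality `d ≤ n * (d - 2)` needs `d ≥ 4`. For `d = 3` it fails at `n = 2`, and the bound
  -- `W ≤ 1` together with the lower bound for `c` compensates.
  rcases hd.eq_or_lt with rfl | hd
  · have hW1 : W ≤ 1 := by
      have := h3 rfl
      omega
    have h4 : 2 * X + Y - r - y ≤ 1 := by omega
    have h5 : 3 * B + 2 ≤ 4 + c + n * B := by
      rcases hn.eq_or_lt with rfl | hn
      · linarith
      · nlinarith
    linarith
  · have hnd : 0 ≤ n * (d - 2) - d := by nlinarith
    have h5 : 0 ≤ (n * (d - 2) - d) * B := mul_nonneg hnd (by linarith)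
    have hX0 : 2 * X - r - y ≤ 1 + 2 * Y - y := by
      have : X ≤ Y + (r + d - 1) / d := by
        by_contra! hlt
        have e1 := Int.lt_mul_ediv_self_add (x := r + d - 1) (show 0 < d by linarith)
        have : d * (Y + (r + d - 1) / d + 1) ≤ d * X :=
          mul_le_mul_of_nonneg_left hlt (by linarith)
        linarith
      have e2 := Int.mul_ediv_self_le (x := r + d - 1) (show d ≠ 0 by linarith)
      have : 2 * ((r + d - 1) / d) ≤ r + 1 := by
        by_contra! hlt
        nlinarith
      linarith
    have hY4 : 4 * Y - y ≤ 3 := by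
      have : 1 ≤ Y := by
        by_contra! hlt
        nlinarith
      nlinarith
    have h6 : 3 * Y + W - y ≤ 3 := by
      have : 1 ≤ Y := by
        by_contra! hlt
        nlinarith
      rcases le_max_iff.1 hW with hW | hW
      · omega
      · omega
    have h7 : n * B * (d - 2) = (n * (d - 2) - d) * B + d * B := by ring
    linarith

namespace Telescopic

variable {m : ℕ} {G : Set ℕ} {e : ℕ} {f : ℤ} {t b : ℕ}

theorem two_le (h : Telescopic m G e f t) (hm : 0 < m) (heb : ¬ e ∣ b) : 2 ≤ e := by
  have := h.pos hm
  by_contra! hlt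
  exact heb (by simp [show e = 1 by omega])

section LastStep

variable (h : Telescopic m G e f t) (hm : 0 < m) (htb : t < b) (heb : ¬ e ∣ b)

include h hm htb heb

theorem mem_closure_insert_iff_of_lt {x : ℕ} (hx : x < b) :
    x ∈ AddSubmonoid.closure (insert b G) ↔ x ∈ AddSubmonoid.closure G :=
  ⟨fun h' => h.mem_closure_of_lt hm htb heb h' hx,
    fun h' => AddSubmonoid.closure_mono (Set.subset_insert _ _) h'⟩

/-- Elements of the semigroup below `b` are multiples of `e ≥ 2`, so no two are consecutive and each
rise after the first is preceded by a fall. -/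
theorem weight_le_add_one {p z : ℕ} (hpz : p ≤ z) (hzb : z ≤ b) :
    semigroupWeight (AddSubmonoid.closure (insert b G)) z ≤
      semigroupWeight (AddSubmonoid.closure (insert b G)) p + 1 := by
  induction z using Nat.strong_induction_on with
  | _ z ih =>
    rcases hpz.eq_or_lt with rfl | hpz
    · omega
    obtain ⟨z, rfl⟩ : ∃ k, z = k + 1 := ⟨z - 1, by omega⟩
    by_cases hz : z ∈ AddSubmonoid.closure (insert b G)
    · rw [semigroupWeight_succ_of_mem hz]
      rcases (Nat.lt_succ_iff.1 hpz).eq_or_lt with rfl | hpz'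
      · rfl
      obtain ⟨z, rfl⟩ : ∃ k, z = k + 1 := ⟨z - 1, by omega⟩
      have hz' : z ∉ AddSubmonoid.closure (insert b G) := by
        intro hz'
        rw [h.mem_closure_insert_iff_of_lt hm htb heb (by omega)] at hz hz'
        have h1 := h.dvd_of_mem_closure hz
        have h2 := h.dvd_of_mem_closure hz'
        have h3 := h.two_le hm heb
        have := Nat.le_of_dvd one_pos ((Nat.dvd_add_right h2).1 h1)
        omega
      rw [semigroupWeight_succ_of_notMem hz']
      have := ih z (by omega) (by omega) (by omega)
      omega
    · rw [semigroupWeight_succ_of_notMem hz]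
      have := ih z (by omega) (by omega) (by omega)
      omega

theorem countBelow_of_dvd {u : ℕ} (hu : e * u ≤ b) :
    countBelow (AddSubmonoid.closure (insert b G)) (e * u) =
      countBelow (rescale e (AddSubmonoid.closure G)) u := by
  rw [countBelow_congr (S' := AddSubmonoid.closure G)
    (fun k hk => h.mem_closure_insert_iff_of_lt hm htb heb (by omega)),
    countBelow_eq_rescale (h.pos hm) (fun a ha => h.dvd_of_mem_closure ha)]
  congr 1
  have := h.pos hm
  rw [show e * u + e - 1 = (e - 1) + e * u by omega, Nat.add_mul_div_left _ _ this,
    Nat.div_eq_of_lt (by omega), zero_add]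

/-- A block of `e` consecutive integers starting at a multiple of `e` below `b` contains at most one
element, so the weight changes by at most `2 - e ≤ 0`. -/
theorem weight_anti {s s' : ℕ} (hss : s ≤ s') (hsb : s' ≤ b) (hs : e ∣ s) (hs' : e ∣ s') :
    semigroupWeight (AddSubmonoid.closure (insert b G)) s' ≤
      semigroupWeight (AddSubmonoid.closure (insert b G)) s := by
  have he := h.two_le hm heb
  obtain ⟨u, rfl⟩ := hs
  obtain ⟨u', rfl⟩ := hs'
  obtain ⟨k, rfl⟩ : ∃ k, u' = u + k :=
    ⟨u' - u, by have := Nat.le_of_mul_le_mul_left hss (h.pos hm); omega⟩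
  rw [semigroupWeight, semigroupWeight, h.countBelow_of_dvd hm htb heb hsb,
    h.countBelow_of_dvd hm htb heb (hss.trans hsb)]
  have h1 := countBelow_add_le (S := rescale e (AddSubmonoid.closure G)) u k
  zify at h1 he
  push_cast
  nlinarith

/-- An element has a unique form `j * b + a` with `j < e`; those with `j = 0` give the first
summand, and removing one `b` from the others gives the second. The bound `z ≤ e * b` prevents `j +
1` from reaching `e` when `b` is added back. -/
theorem countBelow_eq_add (hgcd : e.gcd b = 1) {z : ℕ} (hbz : b ≤ z) (hz : z ≤ e * b) :
    countBelow (AddSubmonoid.closure (insert b G)) z =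
      countBelow (AddSubmonoid.closure G) z +
        countBelow (AddSubmonoid.closure (insert b G)) (z - b) := by
  induction z, hbz using Nat.le_induction with
  | base =>
    rw [Nat.sub_self, countBelow_zero, add_zero]
    exact countBelow_congr fun k hk => h.mem_closure_insert_iff_of_lt hm htb heb hk
  | succ z hbz ih =>
    have ih := ih (by omega)
    have hmem : ∀ x, x ∈ AddSubmonoid.closure (insert b G) ↔
        ∃ j < e, ∃ a ∈ AddSubmonoid.closure G, j * b + a = x := by
      intro x
      rw [h.mem_closure_insert_iff hm htb heb, hgcd, Nat.div_one]
    have huniq : ∀ {i j a a' : ℕ}, i < e → j < e → a ∈ AddSubmonoid.closure G →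
        a' ∈ AddSubmonoid.closure G → i * b + a = j * b + a' → i = j :=
      fun hi hj => h.eq_of_mul_add_eq hm (by rwa [hgcd, Nat.div_one]) (by rwa [hgcd, Nat.div_one])
    rw [show z + 1 - b = z - b + 1 by omega]
    by_cases hzb : z - b ∈ AddSubmonoid.closure (insert b G)
    · have hzS : z ∈ AddSubmonoid.closure (insert b G) := by
        have := add_mem hzb (AddSubmonoid.subset_closure (Set.mem_insert b G))
        rwa [Nat.sub_add_cancel hbz] at this
      have hzA : z ∉ AddSubmonoid.closure G := by
        intro hzA
        obtain ⟨j, hj, a, ha, hja⟩ := (hmem _).1 hzb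
        have hj1 : j + 1 < e := by
          by_contra! hle
          have : e * b ≤ (j + 1) * b := Nat.mul_le_mul_right _ hle
          rw [add_one_mul] at this
          omega
        have := huniq (i := 0) (j := j + 1) (by omega) hj1 hzA ha (by
          rw [add_one_mul]
          omega)
        omega
      rw [countBelow_succ_of_mem hzS, countBelow_succ_of_mem (l := z - b) hzb,
        countBelow_succ_of_notMem hzA, ih]
      omega
    · rw [countBelow_succ_of_notMem (l := z - b) hzb]
      by_cases hzA : z ∈ AddSubmonoid.closure G
      · have hzS : z ∈ AddSubmonoid.closure (insert b G) :=
          AddSubmonoid.closure_mono (Set.subset_insert _ _) hzA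
        rw [countBelow_succ_of_mem hzS, countBelow_succ_of_mem hzA, ih]
        omega
      · have hzS : z ∉ AddSubmonoid.closure (insert b G) := by
          intro hzS
          obtain ⟨j, hj, a, ha, hja⟩ := (hmem _).1 hzS
          rcases j.eq_zero_or_pos with rfl | hj0
          · apply hzA
            rw [← hja]
            simpa using ha
          · refine hzb ((hmem _).2 ⟨j - 1, by omega, a, ha, ?_⟩)
            rw [← hja, Nat.sub_mul, one_mul]
            have : b ≤ j * b := Nat.le_mul_of_pos_left _ hj0
            omega
        rw [countBelow_succ_of_notMem hzS, countBelow_succ_of_notMem hzA, ih]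

end LastStep

end Telescopic

namespace Telescopic

variable {m : ℕ} {G : Set ℕ} {e : ℕ} {f : ℤ} {t : ℕ}

/-- The conductor of the semigroup of a telescopic sequence with greatest common divisor `1`. -/
theorem exists_conductor (h : Telescopic m G 1 f t) (hm : 0 < m) :
    ∃ c : ℕ, f = c - 1 ∧ IsSymmetric (AddSubmonoid.closure G) 1 (c - 1) := by
  have h1 := (h.isSymmetric hm).neg_le one_pos h.dvd_frobenius
  obtain ⟨c, hc⟩ := Int.eq_ofNat_of_zero_le (show 0 ≤ f + 1 by push_cast at h1; omega)
  have hf : f = c - 1 := by omega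
  exact ⟨c, hf, hf ▸ h.isSymmetric hm⟩

/-- With `d` the gcd of the generators before `b` and `c'` the conductor of their semigroup divided
by `d`, splitting off one `b` gives `w(z) = 2⌈z/d⌉ - c' - b + w(z - b)`. While `z - b > b` the added
term is nonpositive and induction applies; the last step is `weight_estimate` with `y = z - b ≤ b`.
-/
theorem weight_le_of_le_two_mul (h : Telescopic m G e f t) (hm : 0 < m) {β b : ℕ} (htβ : t < β)
    (heβ : ¬ e ∣ β) (hb : e / e.gcd β * β < b) (hdb : ¬ e.gcd β ∣ b)
    (hgcd : (e.gcd β).gcd b = 1) {c : ℕ}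
    (hc : (c : ℤ) = f + ((e / e.gcd β : ℕ) - 1) * β + ((e.gcd β : ℕ) - 1) * b + 1) {z : ℕ}
    (hbz : b < z) (hz : 2 * z ≤ c) :
    semigroupWeight (AddSubmonoid.closure (insert b (insert β G))) z ≤
      semigroupWeight (AddSubmonoid.closure (insert b (insert β G))) β := by
  have h1 := h.step β htβ heβ
  have hd2 := h1.two_le hm hdb
  have hn := h.one_lt_div hm heβ
  have hfle := h1.frobenius_le
  have hsym := h1.isSymmetric hm
  have hdf := h1.dvd_frobenius
  have hwd := @Telescopic.countBelow_of_dvd m _ _ _ _ b h1 hm hb hdb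
  have hcount := @Telescopic.countBelow_eq_add m _ _ _ _ b h1 hm hb hdb hgcd
  have hef := (h.isSymmetric hm).neg_le (h.pos hm) h.dvd_frobenius
  have hed : e / e.gcd β * e.gcd β = e := Nat.div_mul_cancel (Nat.gcd_dvd_left _ _)
  obtain ⟨u, hu⟩ : e.gcd β ∣ β := Nat.gcd_dvd_right _ _
  obtain ⟨M, hM⟩ := h.dvd m h.mem
  have hmβ : m < β := (h.le_bound hm m h.mem).trans_lt htβ
  have hA : ∀ a ∈ AddSubmonoid.closure (insert β G), e.gcd β ∣ a :=
    fun a ha => h1.dvd_of_mem_closure ha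
  have hmA : m ∈ AddSubmonoid.closure (insert β G) :=
    AddSubmonoid.subset_closure (Or.inr h.mem)
  clear h1
  generalize hdd : e.gcd β = d at *
  generalize hnn : e / d = n at *
  generalize hff : f + ((n : ℤ) - 1) * β = F at *
  obtain ⟨q, rfl⟩ := hdf
  have hd0 : 0 < d := by omega
  have hr := IsSymmetric.rescale hd0 hA hsym
  have hq0 := hr.neg_le one_pos (by simp)
  obtain ⟨c', hc'⟩ := Int.eq_ofNat_of_zero_le (show 0 ≤ q + 1 by push_cast at hq0; omega)
  obtain rfl : q = c' - 1 := by omega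
  have hbu : d * u ≤ b := by
    rw [← hu]
    exact (Nat.le_mul_of_pos_left _ (by omega)).trans hb.le
  have hMpos : 0 < M := by
    rcases M.eq_zero_or_pos with rfl | h0
    · omega
    · exact h0
  -- the value at `β`
  have hwβ : semigroupWeight (AddSubmonoid.closure (insert b (insert β G))) β =
      2 * (countBelow (rescale d (AddSubmonoid.closure (insert β G))) u : ℤ) - d * u := by
    have := hwd hbu
    rw [← hu] at this
    rw [semigroupWeight, this]
    congr 1
    exact_mod_cast hu
  have hmu : n * M < u := by
    have : d * (n * M) < d * u := by
      rw [← hu]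
      calc d * (n * M) = n * d * M := by ring
        _ = m := by rw [hed, ← hM]
        _ < β := hmβ
    exact Nat.lt_of_mul_lt_mul_left this
  -- Both `0` and `m / d = n * M` lie below `u = β / d`.
  have hH : 2 ≤ countBelow (rescale d (AddSubmonoid.closure (insert β G))) u := by
    have h2 : n * M ∈ rescale d (AddSubmonoid.closure (insert β G)) := by
      rw [mem_rescale]
      have : d * (n * M) = m := by
        rw [hM, ← hed]
        ring
      rwa [this]
    have h3 := countBelow_lt (S := rescale d (AddSubmonoid.closure (insert β G))) h2 hmu
    have h4 := countBelow_lt (S := rescale d (AddSubmonoid.closure (insert β G)))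
      (zero_mem (rescale d (AddSubmonoid.closure (insert β G)))) (show 0 < n * M by positivity)
    omega
  have hB : 3 ≤ u := by
    have : 2 * 1 ≤ n * M := Nat.mul_le_mul hn hMpos
    omega
  -- This is `f ≥ -e = -n * d` inserted into `d * c' = f + (n - 1) * β + d` with `β = d * u`.
  have hcn : ((n : ℤ) - 1) * (u - 1) ≤ c' := by
    have hd' : (0 : ℤ) < d := by exact_mod_cast hd0
    refine le_of_mul_le_mul_left ?_ hd'
    have e1 : (e : ℤ) = n * d := by exact_mod_cast hed.symm
    have e2 : (β : ℤ) = d * u := by exact_mod_cast hu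
    rw [e2] at hff
    rw [e1] at hef
    linarith
  -- the contribution of the multiples of `d`
  have hwA : ∀ x : ℕ, 2 * (countBelow (AddSubmonoid.closure (insert β G)) x : ℤ) =
      semigroupWeight (rescale d (AddSubmonoid.closure (insert β G))) ((x + d - 1) / d) +
        ((x + d - 1) / d : ℕ) := by
    intro x
    rw [countBelow_eq_rescale hd0 hA, two_mul_countBelow]
  have hm2 : (d : ℤ) ≤ m := by
    have : d ≤ m := Nat.le_of_dvd hm ⟨n * M, by rw [hM, ← hed]; ring⟩
    exact_mod_cast this
  have hbt : ((n * β : ℕ) : ℤ) < b := by exact_mod_cast hb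
  -- For `d = 2` the conductor is below `2 * b`, which leaves no room for `b < z ≤ c / 2`.
  have hd3 : 3 ≤ d := by
    by_contra! hlt
    obtain rfl : d = 2 := by omega
    push_cast at hc hfle hbt
    zify at hbz hz
    linarith
  obtain ⟨ceil, hceil⟩ : ∃ ceil : ℕ → ℕ, ∀ x, (x + d - 1) / d = ceil x := ⟨_, fun _ => rfl⟩
  simp only [hceil] at hwA
  have hle : ∀ x : ℕ, x ≤ d * ceil x := by
    intro x
    have e2 := Nat.lt_mul_div_succ (x + d - 1) hd0
    rw [Nat.mul_add, hceil] at e2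
    omega
  have hlt : ∀ x : ℕ, d * ceil x + 1 ≤ x + d := by
    intro x
    have e1 := Nat.div_mul_le_self (x + d - 1) d
    rw [mul_comm, hceil] at e1
    omega
  have hcd : (d : ℤ) * c' < b := by
    push_cast at hfle hbt
    linarith
  have hzdb : ∀ x : ℕ, 2 * x ≤ c → x ≤ d * b := by
    intro x hx
    have e1 : (2 : ℤ) * x ≤ c := by exact_mod_cast hx
    have e2 : (x : ℤ) ≤ d * b := by linarith
    exact_mod_cast e2
  induction z using Nat.strong_induction_on with
  | _ z ih =>
  have hcz := hcount hbz.le (hzdb z hz)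
  have hZc : c' ≤ ceil z := by
    by_contra! hZ
    have e1 : d * ceil z ≤ d * c' := Nat.mul_le_mul_left _ hZ.le
    have e2 := (hle z).trans e1
    zify at e2 hbz
    linarith
  have hwz : semigroupWeight (AddSubmonoid.closure (insert b (insert β G))) z =
      2 * (ceil z : ℤ) - c' - b +
        semigroupWeight (AddSubmonoid.closure (insert b (insert β G))) (z - b) := by
    have e1 := hwA z
    rw [hr.weight_of_le hZc] at e1
    rw [semigroupWeight, semigroupWeight, hcz, Nat.cast_sub hbz.le]
    push_cast at e1 ⊢
    linarith
  by_cases hzb : b < z - b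
  · refine le_trans ?_ (ih (z - b) (by omega) hzb (by omega))
    have e1 : (d : ℤ) * ceil z + 1 ≤ z + d := by exact_mod_cast hlt z
    have e2 : (d : ℤ) < b := by
      have : d * 1 < d * u := Nat.mul_lt_mul_of_pos_left (by omega) hd0
      have : d < b := by omega
      exact_mod_cast this
    have e3 : (2 : ℤ) * z ≤ c := by exact_mod_cast hz
    have e4 : (d : ℤ) * (2 * ceil z) < d * (c' + b) := by linarith
    have e5 := lt_of_mul_lt_mul_left e4 (Nat.cast_nonneg d)
    linarith
  · obtain ⟨y, rfl⟩ : ∃ y, z = b + y := ⟨z - b, by omega⟩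
    rw [Nat.add_sub_cancel_left] at hwz hcz hzb
    have e1 := hwA y
    have e2 := hr.weight_le_max (ceil y)
    have e3 : countBelow (AddSubmonoid.closure (insert b (insert β G))) y =
        countBelow (AddSubmonoid.closure (insert β G)) y := by
      refine countBelow_congr fun k hk => ?_
      exact ⟨fun h' => mem_closure_of_lt (h.step β htβ heβ) hm (by rw [hdd, hnn]; exact hb)
        (by rwa [hdd]) h' (by omega),
        fun h' => AddSubmonoid.closure_mono (Set.subset_insert _ _) h'⟩
    have e4 : semigroupWeight (AddSubmonoid.closure (insert b (insert β G))) y =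
        semigroupWeight (rescale d (AddSubmonoid.closure (insert β G))) (ceil y) + ceil y - y := by
      rw [semigroupWeight, e3, e1]
    rw [hwβ, hwz, e4]
    have hb1 : (n : ℤ) * (d * u) + 1 ≤ b := by
      have : n * (d * u) + 1 ≤ b := by rw [← hu]; exact hb
      exact_mod_cast this
    have hY1 : (y : ℤ) ≤ d * ceil y := by exact_mod_cast hle y
    have hY2 : (d : ℤ) * ceil y + 1 ≤ y + d := by exact_mod_cast hlt y
    have hZ2 : (d : ℤ) * ceil (b + y) + 1 ≤ b + y + d := by exact_mod_cast hlt (b + y)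
    have key := weight_estimate (d := d) (n := n) (B := u) (b := b) (y := y)
      (Y := ceil y) (Z := ceil (b + y)) (c := c')
      (H := countBelow (rescale d (AddSubmonoid.closure (insert β G))) u)
      (W := semigroupWeight (rescale d (AddSubmonoid.closure (insert β G))) (ceil y))
      (by exact_mod_cast hd3) (by exact_mod_cast hn) (by exact_mod_cast hB) hb1
      (by omega) (by linarith) (by linarith) hcn
      (by exact_mod_cast hH) e2 ?_ hY1
    · linarith
    -- For `d = 3` one has `c = 3 * (c' - 1) + 2 * b + 1`, so `2 * (b + y) ≤ c` forces `⌈y / 3⌉ ≤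
    -- c'`.
    · intro hd3'
      have : d = 3 := by exact_mod_cast hd3'
      subst this
      push_cast at hc hz
      omega

/-- The last generator but one (and all smaller ones) of a plane branch semigroup bound the weight
of every local maximum of height at least two. -/
theorem weight_le_of_peak (h : Telescopic m G e f t) (hm : 0 < m) {β b : ℕ} (htβ : t < β)
    (heβ : ¬ e ∣ β) (hb : e / e.gcd β * β < b) (hdb : ¬ e.gcd β ∣ b)
    (hgcd : (e.gcd β).gcd b = 1) {c : ℕ}
    (hc : (c : ℤ) = f + ((e / e.gcd β : ℕ) - 1) * β + ((e.gcd β : ℕ) - 1) * b + 1) {p z q : ℕ}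
    (hpz : p < z) (hzq : z < q)
    (hp : semigroupWeight (AddSubmonoid.closure (insert b (insert β G))) p + 2 ≤
      semigroupWeight (AddSubmonoid.closure (insert b (insert β G))) z)
    (hq : semigroupWeight (AddSubmonoid.closure (insert b (insert β G))) q + 2 ≤
      semigroupWeight (AddSubmonoid.closure (insert b (insert β G))) z) {x : ℕ}
    (hx : x ∈ insert β G) :
    semigroupWeight (AddSubmonoid.closure (insert b (insert β G))) z ≤
      semigroupWeight (AddSubmonoid.closure (insert b (insert β G))) x := by
  have h1 := h.step β htβ heβ
  have hxβ : x ≤ β := by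
    rcases hx with rfl | hx
    · exact le_rfl
    · exact (h.le_bound hm _ hx).trans htβ.le
  have hn := h.one_lt_div hm heβ
  have hβb : β ≤ b := by nlinarith
  -- Among the generators before `b`, the largest one `β` has the least weight, so only `x = β`
  -- needs to be treated.
  refine le_trans ?_ (h1.weight_anti hm hb hdb hxβ hβb (h1.dvd x hx) (Nat.gcd_dvd_right _ _))
  have h2 := h1.step b hb hdb
  have hsym := h2.isSymmetric hm
  rw [hgcd, Nat.div_one] at hsym
  have hcf : f + ((e / e.gcd β : ℕ) - 1 : ℤ) * β + ((e.gcd β : ℕ) - 1 : ℤ) * b = c - 1 := by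
    linarith
  rw [hcf] at hsym
  have hup : ∀ p' z' : ℕ, p' ≤ z' → z' ≤ b → _ := fun p' z' =>
    h1.weight_le_add_one (p := p') (z := z') hm hb hdb
  have hzc : z ≤ c := by
    by_contra! hlt
    rw [hsym.weight_of_le hlt.le, hsym.weight_of_le (hlt.trans hzq).le] at hq
    omega
  have hqc : q ≤ c := by
    by_contra! hlt
    rw [hsym.weight_of_le hlt.le] at hq
    have := hsym.weight_le hzc
    omega
  have hbz : b < z := by
    by_contra! hle
    have := hup p z hpz.le hle
    omega
  -- Reflection turns the fall from `z` to `q` into a rise from `c - q` to `c - z`, which cannot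
  -- take place up to `b`.
  have hbz' : b < c - z := by
    by_contra! hle
    have := hup (c - q) (c - z) (by omega) hle
    rw [hsym.weight_sub hzc, hsym.weight_sub hqc] at this
    omega
  rcases le_total (2 * z) c with hz | hz
  · exact h.weight_le_of_le_two_mul hm htβ heβ hb hdb hgcd hc hbz hz
  · rw [← hsym.weight_sub hzc]
    exact h.weight_le_of_le_two_mul hm htβ heβ hb hdb hgcd hc hbz' (by omega)

/-- The last generator exceeds `2 * β` and contributes at least itself to `c`; the possibly negative
`f ≥ -e ≥ -β` is absorbed by the contribution of `β`. With `c = 2δ` this yields `x ≤ δ`. -/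
theorem two_mul_le_conductor (h : Telescopic m G e f t) (hm : 0 < m) {β b : ℕ} (htβ : t < β)
    (heβ : ¬ e ∣ β) (hb : e / e.gcd β * β < b) (hdb : ¬ e.gcd β ∣ b) {c : ℕ}
    (hc : (c : ℤ) = f + ((e / e.gcd β : ℕ) - 1) * β + ((e.gcd β : ℕ) - 1) * b + 1) {x : ℕ}
    (hx : x ∈ insert β G) : 2 * x ≤ c := by
  have h1 := h.step β htβ heβ
  have hxβ : x ≤ β := by
    rcases hx with rfl | hx
    · exact le_rfl
    · exact (h.le_bound hm _ hx).trans htβ.le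
  have hn := h.one_lt_div hm heβ
  have hd := h1.two_le hm hdb
  have hf := (h.isSymmetric hm).neg_le (h.pos hm) h.dvd_frobenius
  have hem : e ≤ β :=
    ((Nat.le_of_dvd hm (h.dvd m h.mem)).trans (h.le_bound hm m h.mem)).trans htβ.le
  have h2β : 2 * β < b := by nlinarith
  zify at *
  nlinarith

end Telescopic

/-! ### A criterion for the triviality of `U` -/

namespace LatticeCohomology

variable {w : ℕ → ℤ}

theorem X_smul_incl (n : ℤ) (φ : H0Piece w n) :
    (X : ℤ[X]) • incl w n φ = incl w (n - 1) (restrict w n φ) := by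
  rw [incl, Module.AEval'.X_smul_of, U, DirectSum.toModule_lof]
  rfl

/-- A constant in degree `n` is the image under a power of `U` of the same constant in a positive
degree. -/
theorem incl_const_mem_T (n : ℤ) (a : ℤ) : incl w n (LocallyConstant.const _ a) ∈ T w := by
  obtain ⟨k, hk⟩ : ∃ k : ℕ, 0 < n + k := ⟨(1 - n).toNat, by omega⟩
  induction k generalizing n with
  | zero => exact Submodule.subset_span ⟨n, by simpa using hk, _, rfl⟩
  | succ k ih =>
    have h1 := (T w).smul_mem (X : ℤ[X]) (ih (n + 1) (by push_cast at hk; omega))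
    rw [X_smul_incl] at h1
    -- The degree `n + 1 - 1` equals `n` only propositionally, so the constant has to be
    -- transported.
    have key : ∀ n' : ℤ, n' = n → ∀ φ : H0Piece w n', (∀ x, φ x = a) →
        incl w n' φ = incl w n (LocallyConstant.const _ a) := by
      rintro _ rfl φ hφ
      congr 1
      ext x
      exact hφ x
    rwa [key (n + 1 - 1) (by ring) _ (fun x => rfl)] at h1

theorem Icc_subset_sublevel {k : ℤ}
    (h : ∀ p z q : ℕ, p < z → z < q → w p ≤ k - 1 → w q ≤ k - 1 → w z ≤ k)
    {x y : ℝ} (hx : x ∈ sublevel w (k - 1)) (hy : y ∈ sublevel w (k - 1)) :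
    Set.Icc x y ⊆ sublevel w k := by
  have key : ∀ z : ℕ, ⌊x⌋₊ ≤ z → z ≤ ⌈y⌉₊ → w z ≤ k := by
    intro z hxz hzy
    have hx' := (le_max_left _ _).trans hx.2
    have hy' := (le_max_right _ _).trans hy.2
    rcases hxz.eq_or_lt with rfl | hxz
    · omega
    rcases hzy.eq_or_lt with rfl | hzy
    · omega
    exact h _ z _ hxz hzy hx' hy'
  rintro z ⟨hxz, hzy⟩
  have h1 := Nat.floor_le_floor hxz
  have h2 := Nat.ceil_le_ceil hzy
  have h3 := Nat.floor_le_ceil z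
  exact ⟨hx.1.trans hxz, max_le (key _ h1 (h3.trans h2)) (key _ (h1.trans h3) h2)⟩

/-- Any two points of `S_{k-1}` are joined by an interval inside `S_k`, on which a locally constant
function is constant. -/
theorem exists_restrict_eq_const {k : ℤ}
    (h : ∀ p z q : ℕ, p < z → z < q → w p ≤ k - 1 → w q ≤ k - 1 → w z ≤ k) (φ : H0Piece w k) :
    ∃ a : ℤ, restrict w k φ = LocallyConstant.const _ a := by
  have hmono := sublevel_mono w (sub_le_self k zero_le_one)
  have key : ∀ x y : sublevel w (k - 1), (x : ℝ) ≤ y →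
      φ (Set.inclusion hmono x) = φ (Set.inclusion hmono y) := by
    intro x y hxy
    have hsub := Icc_subset_sublevel h x.2 y.2
    have hpre : IsPreconnected ((Set.inclusion hsub) '' Set.univ) := by
      have : PreconnectedSpace (Set.Icc (x : ℝ) y) :=
        Subtype.preconnectedSpace isPreconnected_Icc
      exact isPreconnected_univ.image _ (continuous_inclusion hsub).continuousOn
    exact φ.isLocallyConstant.apply_eq_of_isPreconnected hpre
      ⟨⟨x, Set.left_mem_Icc.2 hxy⟩, trivial, rfl⟩ ⟨⟨y, Set.right_mem_Icc.2 hxy⟩, trivial, rfl⟩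
  rcases isEmpty_or_nonempty (sublevel w (k - 1)) with he | ⟨⟨x⟩⟩
  · exact ⟨0, by ext x; exact (he.false x).elim⟩
  · refine ⟨φ (Set.inclusion hmono x), ?_⟩
    ext y
    rcases le_total (x : ℝ) y with hxy | hxy
    · exact (key x y hxy).symm
    · exact key y x hxy

theorem mem_stable {n : ℤ} (hl : ∃ l, w l ≤ n)
    (h : ∀ k : ℤ, n ≤ k → ∀ p z q : ℕ, p < z → z < q → w p ≤ k - 1 → w q ≤ k - 1 → w z ≤ k) :
    n ∈ stable w := by
  refine ⟨hl, fun q => ?_⟩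
  obtain ⟨⟨x, hx⟩, rfl⟩ := Submodule.Quotient.mk_surjective _ q
  rw [← Submodule.Quotient.mk_smul, Submodule.Quotient.mk_eq_zero]
  change (X : ℤ[X]) • x ∈ T w
  induction hx using Submodule.span_induction with
  | mem x hx =>
    obtain ⟨k, hk, φ, rfl⟩ := hx
    obtain ⟨a, ha⟩ := exists_restrict_eq_const (h k hk) φ
    rw [X_smul_incl, ha]
    exact incl_const_mem_T _ _
  | zero =>
    rw [smul_zero]
    exact zero_mem _
  | add x y _ _ h1 h2 =>
    rw [smul_add]
    exact add_mem h1 h2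
  | smul p x _ h1 =>
    rw [smul_comm]
    exact (T w).smul_mem p h1

end LatticeCohomology

namespace IsSymmetric

variable {S : AddSubmonoid ℕ} {c : ℕ}

theorem neg_le_weight (h : IsSymmetric S 1 (c - 1)) (l : ℕ) : -(c : ℤ) ≤ semigroupWeight S l := by
  rcases le_total l c with hl | hl
  · rw [semigroupWeight]
    omega
  · rw [h.weight_of_le hl]
    omega

theorem bddBelow_stable (h : IsSymmetric S 1 (c - 1)) :
    BddBelow (LatticeCohomology.stable (semigroupWeight S)) :=
  ⟨-c, fun _ hn => let ⟨l, hl⟩ := hn.1; (h.neg_le_weight l).trans hl⟩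

/-- Up to the conductor the weight is at most `1`, and beyond it the weight increases, so no
obstructing peak exists at levels `k ≥ 1`. This makes the set of stable integers nonempty. -/
theorem one_mem_stable (h : IsSymmetric S 1 (c - 1)) :
    1 ∈ LatticeCohomology.stable (semigroupWeight S) := by
  refine LatticeCohomology.mem_stable ⟨0, by rw [semigroupWeight_zero]; norm_num⟩ ?_
  intro k hk p z q _ hzq _ hq
  rcases le_total z c with hz | hz
  · exact (h.weight_le hz).trans hk
  · rw [h.weight_of_le hz]
    rw [h.weight_of_le (hz.trans hzq.le)] at hq
    omega

theorem isLeast_stable (h : IsSymmetric S 1 (c - 1)) :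
    IsLeast (LatticeCohomology.stable (semigroupWeight S))
      (sInf (LatticeCohomology.stable (semigroupWeight S))) :=
  ⟨Int.csInf_mem ⟨1, h.one_mem_stable⟩ h.bddBelow_stable,
    fun _ hn => csInf_le h.bddBelow_stable hn⟩

end IsSymmetric

/-! ### Valuations of polynomials along a parametrized curve -/

/-- The properties of the order of vanishing of polynomials `P(x, y)` along a parametrized curve
with `ord x = m ≤ ord y`. -/
structure IsCurveValuation {K : Type*} [Field K] (m : ℕ) (v : K[X][X] → ℕ∞) : Prop where
  map_zero : v 0 = ⊤
  map_mul : ∀ P Q, v (P * Q) = v P + v Q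
  min_le_add : ∀ P Q, min (v P) (v Q) ≤ v (P + Q)
  map_const : ∀ c : K, c ≠ 0 → v (C (C c)) = 0
  exists_lt_sub : ∀ P Q, v P = v Q → v P ≠ ⊤ → ∃ c : K, v P < v (P - C (C c) * Q)
  map_C_X : v (C X) = m
  le_map_X : (m : ℕ∞) ≤ v X

namespace IsCurveValuation

variable {K : Type*} [Field K] {m : ℕ} {v : K[X][X] → ℕ∞}

theorem map_neg (hv : IsCurveValuation m v) (P : K[X][X]) : v (-P) = v P := by
  have h1 : -P = C (C (-1)) * P := by simp only [Polynomial.C_neg, Polynomial.C_1]; ring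
  rw [h1, hv.map_mul, hv.map_const _ (by simp), zero_add]

theorem min_le_sub (hv : IsCurveValuation m v) (P Q : K[X][X]) :
    min (v P) (v Q) ≤ v (P - Q) := by
  rw [sub_eq_add_neg, ← hv.map_neg Q]
  exact hv.min_le_add _ _

theorem map_add_of_lt (hv : IsCurveValuation m v) {P Q : K[X][X]} (h : v P < v Q) :
    v (P + Q) = v P := by
  apply le_antisymm
  · by_contra! hlt
    have h1 := hv.min_le_sub (P + Q) Q
    rw [add_sub_cancel_right] at h1
    exact (lt_min hlt h).not_ge h1
  · have h1 := hv.min_le_add P Q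
    rwa [min_eq_left h.le] at h1

theorem map_one (hv : IsCurveValuation m v) : v 1 = 0 := by
  simpa using hv.map_const 1 one_ne_zero

theorem map_pow (hv : IsCurveValuation m v) (P : K[X][X]) (n : ℕ) : v (P ^ n) = n * v P := by
  induction n with
  | zero => simp [hv.map_one]
  | succ n ih =>
    rw [pow_succ, hv.map_mul, ih]
    push_cast
    ring

theorem ne_zero (hv : IsCurveValuation m v) {P : K[X][X]} {k : ℕ} (h : v P = k) : P ≠ 0 := by
  rintro rfl
  rw [hv.map_zero] at h
  exact ENat.top_ne_natCast _ h

/-- The values of the polynomials in `y` of degree less than `D` are the elements of the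
semigroup generated by the telescopic sequence `G`, and there is a monic polynomial of degree `D`
with value at least `t`. -/
structure Stage (m : ℕ) (v : K[X][X] → ℕ∞) (G : Set ℕ) (e : ℕ) (f : ℤ) (t D : ℕ) : Prop where
  telescopic : Telescopic m G e f t
  pos : 0 < D
  exists_eq : ∀ P : K[X][X], P ≠ 0 → P.natDegree < D → ∃ a ∈ AddSubmonoid.closure G, v P = a
  exists_poly : ∀ a ∈ AddSubmonoid.closure G, ∃ P : K[X][X], P.natDegree < D ∧ v P = a
  exists_monic : ∃ Q : K[X][X], Q.Monic ∧ Q.natDegree = D ∧ (t : ℕ∞) ≤ v Q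

/-- A polynomial in `x` with nonzero constant term has value `0`; each factor `x` contributes `m`.
-/
theorem exists_map_C_eq (hv : IsCurveValuation m v) (hm : 0 < m) (p : K[X]) (hp : p ≠ 0) :
    ∃ j : ℕ, v (C p) = (j * m : ℕ) := by
  induction hd : p.natDegree using Nat.strong_induction_on generalizing p with
  | _ d ih =>
  by_cases h0 : p.coeff 0 = 0
  · have hdiv : p = X * p.divX := by
      conv_lhs => rw [← divX_mul_X_add p, h0, Polynomial.C_0, add_zero, mul_comm]
    have hne : p.divX ≠ 0 := by
      intro h
      rw [h, mul_zero] at hdiv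
      exact hp hdiv
    have hdeg : d ≠ 0 := by
      rintro rfl
      apply hp
      rw [eq_C_of_natDegree_eq_zero hd, h0, Polynomial.C_0]
    obtain ⟨j, hj⟩ := ih (p.divX.natDegree) (by rw [natDegree_divX_eq_natDegree_tsub_one]; omega)
      p.divX hne rfl
    refine ⟨j + 1, ?_⟩
    rw [hdiv, Polynomial.C_mul, hv.map_mul, hj, hv.map_C_X]
    push_cast
    ring
  · refine ⟨0, ?_⟩
    have h1 : C p = C (C (p.coeff 0)) + C X * C p.divX := by
      rw [← Polynomial.C_mul, ← Polynomial.C_add, add_comm, mul_comm, divX_mul_X_add]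
    rw [h1, hv.map_add_of_lt, hv.map_const _ h0, zero_mul, Nat.cast_zero]
    rw [hv.map_const _ h0, hv.map_mul, hv.map_C_X]
    exact lt_of_lt_of_le (by exact_mod_cast hm) le_self_add

theorem stage_base (hv : IsCurveValuation m v) (hm : 0 < m) : Stage m v {m} m (-m) m 1 where
  telescopic := .base
  pos := one_pos
  exists_eq P hP hd := by
    obtain ⟨p, rfl⟩ : ∃ p, P = C p := ⟨_, eq_C_of_natDegree_eq_zero (by omega)⟩
    obtain ⟨j, hj⟩ := hv.exists_map_C_eq hm p (by rintro rfl; simp at hP)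
    exact ⟨j * m, AddSubmonoid.mem_closure_singleton.2 ⟨j, rfl⟩, hj⟩
  exists_poly a ha := by
    obtain ⟨j, rfl⟩ := AddSubmonoid.mem_closure_singleton.1 ha
    refine ⟨(C X) ^ j, ?_, ?_⟩
    · rw [← Polynomial.C_pow, natDegree_C]
      exact one_pos
    · rw [hv.map_pow, hv.map_C_X]
      simp
  exists_monic := ⟨X, monic_X, natDegree_X, hv.le_map_X⟩

/-- Polynomials of degree below `(e / gcd) * D` are expanded in base `Q` with digits of degree below
`D`. The terms of the expansion have different values, so the value of the sum is the least of them.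
-/
theorem Stage.step (hv : IsCurveValuation m v) (hm : 0 < m) {G : Set ℕ} {e : ℕ} {f : ℤ}
    {t D : ℕ} (h : Stage m v G e f t D) {Q : K[X][X]} (hQ : Q.Monic) (hQD : Q.natDegree = D)
    {b : ℕ} (hb : v Q = b) (htb : t < b) (heb : ¬ e ∣ b) :
    Stage m v (insert b G) (e.gcd b) (f + ((e / e.gcd b : ℕ) - 1) * b) (e / e.gcd b * b)
      (e / e.gcd b * D) where
  telescopic := h.telescopic.step b htb heb
  pos := Nat.mul_pos (one_pos.trans (h.telescopic.one_lt_div hm heb)) h.pos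
  exists_eq P hP hd := by
    have key : ∀ k ≤ e / e.gcd b, ∀ P : K[X][X], P ≠ 0 → P.natDegree < k * D →
        ∃ j < k, ∃ a ∈ AddSubmonoid.closure G, v P = (j * b + a : ℕ) := by
      intro k
      induction k with
      | zero =>
        intro _ P _ hP
        omega
      | succ k ih =>
        intro hk P hP hd
        have hQ1 : Q ≠ 1 := by
          rintro rfl
          rw [natDegree_one] at hQD
          exact h.pos.ne hQD
        have hdiv := modByMonic_add_div P Q
        have hmod := natDegree_modByMonic_lt P hQ hQ1
        rw [hQD] at hmod
        have hT : P /ₘ Q ≠ 0 → (P /ₘ Q).natDegree < k * D := by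
          intro hT
          have h1 : ¬ P.degree < Q.degree := fun h' => hT ((divByMonic_eq_zero_iff hQ).2 h')
          have h2 := natDegree_le_natDegree (not_lt.1 h1)
          rw [natDegree_divByMonic _ hQ]
          rw [add_one_mul] at hd
          omega
        by_cases hT0 : P /ₘ Q = 0
        · rw [hT0, mul_zero, add_zero] at hdiv
          rw [hdiv] at hmod
          obtain ⟨a, ha, hva⟩ := h.exists_eq P hP hmod
          exact ⟨0, k.succ_pos, a, ha, by simpa using hva⟩
        obtain ⟨j, hj, a, ha, hva⟩ := ih (by omega) _ hT0 (hT hT0)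
        have hQT : v (Q * (P /ₘ Q)) = ((j + 1) * b + a : ℕ) := by
          rw [hv.map_mul, hb, hva]
          push_cast
          ring
        by_cases hR0 : P %ₘ Q = 0
        · rw [hR0, zero_add] at hdiv
          rw [hdiv] at hQT
          exact ⟨j + 1, by omega, a, ha, hQT⟩
        obtain ⟨a', ha', hva'⟩ := h.exists_eq _ hR0 hmod
        -- The two values have different indices `j + 1` and `0`, and the index is determined by the
        -- value.
        have hne : (j + 1) * b + a ≠ a' := by
          intro heq
          have := h.telescopic.eq_of_mul_add_eq hm (b := b) (i := j + 1) (j := 0) (by omega) (by omega)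
            ha ha' (by simpa using heq)
          omega
        rcases hne.lt_or_gt with hlt | hlt
        · refine ⟨j + 1, by omega, a, ha, ?_⟩
          rw [← hdiv, add_comm, hv.map_add_of_lt, hQT]
          rw [hQT, hva']
          exact_mod_cast hlt
        · refine ⟨0, k.succ_pos, a', ha', ?_⟩
          rw [← hdiv, hv.map_add_of_lt, hva', zero_mul, zero_add]
          rw [hQT, hva']
          exact_mod_cast hlt
    obtain ⟨j, hj, a, ha, hva⟩ := key _ le_rfl P hP hd
    exact ⟨_, (h.telescopic.mem_closure_insert_iff hm htb heb).2 ⟨j, hj, a, ha, rfl⟩, hva⟩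
  exists_poly x hx := by
    obtain ⟨j, hj, a, ha, rfl⟩ := (h.telescopic.mem_closure_insert_iff hm htb heb).1 hx
    obtain ⟨P, hP, hva⟩ := h.exists_poly a ha
    refine ⟨Q ^ j * P, ?_, ?_⟩
    · calc (Q ^ j * P).natDegree ≤ (Q ^ j).natDegree + P.natDegree := natDegree_mul_le
        _ = j * D + P.natDegree := by rw [hQ.natDegree_pow, hQD]
        _ < (j + 1) * D := by rw [add_one_mul]; omega
        _ ≤ _ := Nat.mul_le_mul_right _ hj
    · rw [hv.map_mul, hv.map_pow, hb, hva]
      push_cast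
      ring
  exists_monic := ⟨Q ^ (e / e.gcd b), hQ.pow _, by rw [hQ.natDegree_pow, hQD], by
    rw [hv.map_pow, hb]
    push_cast
    exact le_rfl⟩

theorem Stage.mem_bound (hm : 0 < m) {G : Set ℕ} {e : ℕ} {f : ℤ} {t D : ℕ}
    (h : Stage m v G e f t D) {k : ℕ} (htk : t ≤ k) (hek : e ∣ k) :
    k ∈ AddSubmonoid.closure G := by
  have := h.telescopic.frobenius_le
  exact (h.telescopic.isSymmetric hm).mem_of_lt hek (by omega)

/-- If the gcd of the values is `1`, then they form a semigroup generated by a telescopic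
sequence. -/
theorem exists_telescopic (hv : IsCurveValuation m v) (hm : 0 < m)
    (hgcd : ∀ e : ℕ, 2 ≤ e → (∀ P, ∀ k : ℕ, v P = k → e ∣ k) →
      ∀ P Q, ∀ k : ℕ, v Q = k → v P ≠ (k + e : ℕ)) :
    ∃ G f t, Telescopic m G 1 f t ∧
      ∀ k : ℕ, (∃ P, v P = k) ↔ k ∈ AddSubmonoid.closure G := by
  suffices key : ∀ e : ℕ, ∀ G f t D, Stage m v G e f t D → ∃ G f t, Telescopic m G 1 f t ∧
      ∀ k : ℕ, (∃ P, v P = k) ↔ k ∈ AddSubmonoid.closure G from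
    key _ _ _ _ _ (hv.stage_base hm)
  intro e
  induction e using Nat.strong_induction_on with
  | _ e ih =>
  intro G f t D h
  by_cases hex : ∃ Q : K[X][X], Q.Monic ∧ Q.natDegree = D ∧ ∃ b : ℕ, v Q = b ∧ t ≤ b ∧
      b ∉ AddSubmonoid.closure G
  · obtain ⟨Q, hQ, hQD, b, hb, htb, hbG⟩ := hex
    have heb : ¬ e ∣ b := fun heb => hbG (h.mem_bound hm htb heb)
    have htb' : t < b := by
      refine htb.lt_of_ne ?_
      rintro rfl
      exact heb h.telescopic.dvd_bound
    refine ih (e.gcd b) ?_ _ _ _ _ (h.step hv hm hQ hQD hb htb' heb)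
    refine (Nat.gcd_le_left _ (h.telescopic.pos hm)).lt_of_ne fun heq => heb ?_
    rw [← heq]
    exact Nat.gcd_dvd_right _ _
  -- No monic polynomial of degree `D` has a new finite value from `t` on. Its value is thus
  -- attained by a polynomial of lower degree, and subtracting a suitable multiple raises the value
  -- while keeping the polynomial monic of degree `D`.
  have hunb : ∀ N : ℕ, ∃ Q : K[X][X], Q.Monic ∧ Q.natDegree = D ∧ (t : ℕ∞) ≤ v Q ∧
      (N : ℕ∞) ≤ v Q := by
    intro N
    induction N with
    | zero =>
      obtain ⟨Q, h1, h2, h3⟩ := h.exists_monic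
      exact ⟨Q, h1, h2, h3, by simp⟩
    | succ N ihN =>
      obtain ⟨Q, h1, h2, h3, h4⟩ := ihN
      rcases h4.eq_or_lt with h4 | h4
      · have hN : N ∈ AddSubmonoid.closure G := by
          by_contra hN
          exact hex ⟨Q, h1, h2, N, h4.symm, by rw [← h4] at h3; exact_mod_cast h3, hN⟩
        obtain ⟨R, hR, hvR⟩ := h.exists_poly N hN
        obtain ⟨c, hc⟩ := hv.exists_lt_sub Q R (by rw [hvR, h4])
          (by rw [← h4]; exact ENat.natCast_ne_top N)
        have hdeg : (C (C c) * R).degree < Q.degree := by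
          refine degree_lt_degree ((natDegree_C_mul_le _ _).trans_lt ?_)
          rwa [h2]
        refine ⟨Q - C (C c) * R, h1.sub_of_left hdeg, ?_, h3.trans hc.le, ?_⟩
        · rw [← h2]
          exact natDegree_eq_of_degree_eq (degree_sub_eq_left_of_degree_lt hdeg)
        · rw [← h4] at hc
          push_cast
          exact Order.add_one_le_of_lt hc
      · refine ⟨Q, h1, h2, h3, ?_⟩
        push_cast
        exact Order.add_one_le_of_lt h4
  have hval : ∀ k : ℕ, (∃ P, v P = k) ↔ k ∈ AddSubmonoid.closure G := by
    intro k
    constructor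
    · rintro ⟨P, hP⟩
      -- Modulo a `Q` of value greater than `k`, the polynomial `P` keeps its value and has degree
      -- below `D`.
      obtain ⟨Q, hQ, hQD, -, hQk⟩ := hunb (k + 1)
      have hQ1 : Q ≠ 1 := by
        rintro rfl
        rw [natDegree_one] at hQD
        exact h.pos.ne hQD
      have hmod := natDegree_modByMonic_lt P hQ hQ1
      rw [hQD] at hmod
      have hR : v (P %ₘ Q) = k := by
        rw [← hP, modByMonic_eq_sub_mul_div _ Q, sub_eq_add_neg, hv.map_add_of_lt]
        rw [hv.map_neg, hv.map_mul, hP]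
        refine lt_of_lt_of_le ?_ (hQk.trans le_self_add)
        exact_mod_cast k.lt_succ_self
      obtain ⟨a, ha, hva⟩ := h.exists_eq _ (hv.ne_zero hR) hmod
      rw [hR] at hva
      rwa [Nat.cast_injective hva]
    · intro hk
      obtain ⟨P, -, hP⟩ := h.exists_poly k hk
      exact ⟨P, hP⟩
  -- Both `t` and `t + e` are multiples of `e` from `t` on, hence values, which `hgcd` excludes for
  -- `e ≥ 2`.
  have he : e = 1 := by
    have hpos := h.telescopic.pos hm
    by_contra hne
    obtain ⟨Q, hQ⟩ := (hval t).2 (h.mem_bound hm le_rfl h.telescopic.dvd_bound)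
    obtain ⟨P, hP⟩ := (hval (t + e)).2
      (h.mem_bound hm (Nat.le_add_right _ _) (dvd_add h.telescopic.dvd_bound dvd_rfl))
    exact hgcd e (by omega)
      (fun P k hP => h.telescopic.dvd_of_mem_closure ((hval k).1 ⟨P, hP⟩)) P Q t hQ hP
  subst he
  exact ⟨G, f, t, h.telescopic, hval⟩

end IsCurveValuation

/-! ### The order of germs in one variable -/

theorem analyticOrderAt_pow_zero (k : ℕ) :
    analyticOrderAt (fun t : ℂ => t ^ k) 0 = k := by
  have h := analyticOrderAt_pow (f := (id : ℂ → ℂ)) analyticAt_id (z₀ := 0) k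
  rw [analyticOrderAt_id, nsmul_one] at h
  exact h

namespace HolGerm

theorem exists_mk {E : Type*} [NormedAddCommGroup E] [NormedSpace ℂ E] (g : HolGerm E) :
    ∃ (h : E → ℂ) (hh : AnalyticAt ℂ h 0), mk h hh = g := by
  obtain ⟨_, h, hh, rfl⟩ := g
  exact ⟨h, hh, rfl⟩

theorem mk_eq_mk {E : Type*} [NormedAddCommGroup E] [NormedSpace ℂ E] {h k : E → ℂ}
    {hh : AnalyticAt ℂ h 0} {hk : AnalyticAt ℂ k 0} : mk h hh = mk k hk ↔ h =ᶠ[𝓝 0] k := by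
  exact Subtype.ext_iff.trans Germ.coe_eq

theorem ord_mk (h : ℂ → ℂ) (hh : AnalyticAt ℂ h 0) : ord (mk h hh) = analyticOrderAt h 0 := rfl

theorem mk_mul {E : Type*} [NormedAddCommGroup E] [NormedSpace ℂ E] {h k : E → ℂ}
    (hh : AnalyticAt ℂ h 0) (hk : AnalyticAt ℂ k 0) : mk h hh * mk k hk = mk (h * k) (hh.mul hk) :=
  rfl

theorem mk_sub {E : Type*} [NormedAddCommGroup E] [NormedSpace ℂ E] {h k : E → ℂ}
    (hh : AnalyticAt ℂ h 0) (hk : AnalyticAt ℂ k 0) : mk h hh - mk k hk = mk (h - k) (hh.sub hk) :=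
  rfl

theorem smul_mk {E : Type*} [NormedAddCommGroup E] [NormedSpace ℂ E] {h : E → ℂ}
    (c : ℂ) (hh : AnalyticAt ℂ h 0) : c • mk h hh = mk (c • h) hh.const_smul :=
  rfl

theorem ord_eq_top {a : HolGerm ℂ} : ord a = ⊤ ↔ a = 0 := by
  obtain ⟨h, hh, rfl⟩ := exists_mk a
  rw [ord_mk, analyticOrderAt_eq_top]
  exact (mk_eq_mk (hk := analyticAt_const (v := (0 : ℂ)))).symm

theorem ord_zero : ord (0 : HolGerm ℂ) = ⊤ := ord_eq_top.2 rfl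

theorem ord_mul (a b : HolGerm ℂ) : ord (a * b) = ord a + ord b := by
  obtain ⟨h, hh, rfl⟩ := exists_mk a
  obtain ⟨k, hk, rfl⟩ := exists_mk b
  exact analyticOrderAt_mul hh hk

theorem min_le_ord_add (a b : HolGerm ℂ) : min (ord a) (ord b) ≤ ord (a + b) := by
  obtain ⟨h, hh, rfl⟩ := exists_mk a
  obtain ⟨k, hk, rfl⟩ := exists_mk b
  exact le_analyticOrderAt_add

theorem ord_algebraMap {c : ℂ} (hc : c ≠ 0) : ord (algebraMap ℂ (HolGerm ℂ) c) = 0 := by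
  have : algebraMap ℂ (HolGerm ℂ) c = mk (fun _ => c) analyticAt_const := by
    rw [Algebra.algebraMap_eq_smul_one]
    refine Eq.trans (smul_mk c (analyticAt_const (v := (1 : ℂ)))) (mk_eq_mk.2 ?_)
    exact Eventually.of_forall fun x => by simp
  rw [this, ord_mk, analyticAt_const.analyticOrderAt_eq_zero]
  exact hc

theorem ord_one : ord (1 : HolGerm ℂ) = 0 := by
  simpa using ord_algebraMap one_ne_zero

theorem ord_pow (a : HolGerm ℂ) (n : ℕ) : ord (a ^ n) = n * ord a := by
  induction n with
  | zero => simp [ord_one]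
  | succ n ih =>
    rw [pow_succ, ord_mul, ih]
    push_cast
    ring

theorem ord_smul {c : ℂ} (hc : c ≠ 0) (a : HolGerm ℂ) : ord (c • a) = ord a := by
  rw [Algebra.smul_def, ord_mul, ord_algebraMap hc, zero_add]

theorem ord_neg (a : HolGerm ℂ) : ord (-a) = ord a := by
  rw [← neg_one_smul ℂ, ord_smul (by norm_num)]

theorem min_le_ord_sub (a b : HolGerm ℂ) : min (ord a) (ord b) ≤ ord (a - b) := by
  rw [sub_eq_add_neg, ← ord_neg b]
  exact min_le_ord_add _ _

/-- The constant is the quotient of the leading coefficients. -/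
theorem exists_lt_ord_sub {a b : HolGerm ℂ} (h : ord a = ord b) (ha : ord a ≠ ⊤) :
    ∃ c : ℂ, ord a < ord (a - c • b) := by
  obtain ⟨f, hf, rfl⟩ := exists_mk a
  obtain ⟨g, hg, rfl⟩ := exists_mk b
  obtain ⟨k, hk⟩ := ENat.ne_top_iff_exists.1 ha
  rw [ord_mk] at hk
  rw [ord_mk, ord_mk, ← hk] at h
  obtain ⟨f', hf', hf0, hff⟩ := (hf.analyticOrderAt_eq_natCast).1 hk.symm
  obtain ⟨g', hg', hg0, hgg⟩ := (hg.analyticOrderAt_eq_natCast).1 h.symm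
  refine ⟨f' 0 / g' 0, ?_⟩
  set c := f' 0 / g' 0
  have hfg : AnalyticAt ℂ (f' - c • g') 0 := hf'.sub hg'.const_smul
  have hpow : AnalyticAt ℂ (fun t : ℂ => t ^ k) 0 := by fun_prop
  have e : f - c • g =ᶠ[𝓝 0] (fun t => t ^ k) * (f' - c • g') := by
    filter_upwards [hff, hgg] with t h1 h2
    simp only [sub_zero, smul_eq_mul] at h1 h2
    simp only [Pi.sub_apply, Pi.smul_apply, Pi.mul_apply, smul_eq_mul, h1, h2]
    ring
  rw [ord_mk, smul_mk, mk_sub, ord_mk, ← hk, analyticOrderAt_congr e, analyticOrderAt_mul hpow hfg,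
    analyticOrderAt_pow_zero]
  have h1 : analyticOrderAt (f' - c • g') 0 ≠ 0 := by
    rw [hfg.analyticOrderAt_ne_zero]
    simp only [Pi.sub_apply, Pi.smul_apply, smul_eq_mul, c]
    rw [div_mul_cancel₀ _ hg0, sub_self]
  calc (k : ℕ∞) < k + 1 := by exact_mod_cast k.lt_succ_self
    _ ≤ k + analyticOrderAt (f' - c • g') 0 := by
      gcongr
      exact Order.one_le_iff_ne_zero.2 h1

theorem le_ord_of_isBigO {f : ℂ → ℂ} (hf : AnalyticAt ℂ f 0) {N : ℕ}
    (h : f =O[𝓝 0] fun t => ‖t‖ ^ N) : (N : ℕ∞) ≤ analyticOrderAt f 0 := by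
  by_contra! hlt
  obtain ⟨k, hk⟩ := ENat.ne_top_iff_exists.1 hlt.ne_top
  rw [← hk] at hlt
  have hkN : k < N := by exact_mod_cast hlt
  obtain ⟨g, hg, hg0, hfg⟩ := (hf.analyticOrderAt_eq_natCast).1 hk.symm
  obtain ⟨K, hK⟩ := h.bound
  apply hg0
  have h1 : Tendsto g (𝓝[≠] 0) (𝓝 (g 0)) := hg.continuousAt.tendsto.mono_left nhdsWithin_le_nhds
  refine tendsto_nhds_unique h1 ?_
  have h2 : Tendsto (fun t : ℂ => K * ‖t‖ ^ (N - k)) (𝓝[≠] 0) (𝓝 0) := by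
    have : ContinuousAt (fun t : ℂ => K * ‖t‖ ^ (N - k)) 0 := by fun_prop
    have h3 := this.tendsto
    rw [norm_zero, zero_pow (by omega), mul_zero] at h3
    exact h3.mono_left nhdsWithin_le_nhds
  refine squeeze_zero_norm' ?_ h2
  filter_upwards [nhdsWithin_le_nhds hK, nhdsWithin_le_nhds hfg, self_mem_nhdsWithin]
    with t ht ht' ht0
  have htpos : 0 < ‖t‖ ^ k := pow_pos (norm_pos_iff.2 ht0) k
  rw [ht', sub_zero, norm_smul, norm_pow, norm_pow, norm_norm] at ht
  refine le_of_mul_le_mul_left (ht.trans (le_of_eq ?_)) htpos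
  rw [← Nat.sub_add_cancel hkN.le, pow_add, Nat.add_sub_cancel]
  ring

end HolGerm

/-! ### The Hilbert function counts semigroup elements -/

/-- The filtration drops by one dimension at `l ∈ S` and not at all otherwise. Finiteness is carried
through the induction because rank-nullity for `finrank` requires it. -/
theorem finite_and_finrank_quotient {K R V : Type*} [Field K] [Ring R] [Algebra K R]
    [AddCommGroup V] [Module R V] [Module K V] [IsScalarTower K R V]
    (F : ℕ → Submodule R V) (S : Set ℕ) (h0 : F 0 = ⊤) (hle : ∀ l, F (l + 1) ≤ F l)
    (hmem : ∀ l ∈ S, ∃ f ∈ F l, f ∉ F (l + 1) ∧ ∀ a ∈ F l, ∃ c : K, a - c • f ∈ F (l + 1))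
    (hnot : ∀ l ∉ S, F l ≤ F (l + 1)) (l : ℕ) :
    Module.Finite K (V ⧸ F l) ∧ Module.finrank K (V ⧸ F l) = countBelow S l := by
  induction l with
  | zero =>
    have : Subsingleton (V ⧸ F 0) := Submodule.Quotient.subsingleton_iff.2 h0
    exact ⟨inferInstance, by rw [Module.finrank_zero_of_subsingleton, countBelow_zero]⟩
  | succ l ih =>
    obtain ⟨hfin, hrank⟩ := ih
    let g : (V ⧸ F (l + 1)) →ₗ[K] (V ⧸ F l) := (Submodule.factor (hle l)).restrictScalars K
    have hg : Function.Surjective g := Submodule.factor_surjective (hle l)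
    have hker : ∀ a : V, Submodule.Quotient.mk a ∈ LinearMap.ker g ↔ a ∈ F l := fun a => by
      rw [LinearMap.mem_ker]
      exact Submodule.Quotient.mk_eq_zero _
    have key : Module.Finite K (LinearMap.ker g) ∧ Module.finrank K (LinearMap.ker g) =
        countBelow S (l + 1) - countBelow S l := by
      by_cases hl : l ∈ S
      · obtain ⟨f, hf, hf', hspan⟩ := hmem l hl
        have hspan : LinearMap.ker g = Submodule.span K {Submodule.Quotient.mk f} := by
          apply le_antisymm
          · intro x hx
            obtain ⟨a, rfl⟩ := Submodule.Quotient.mk_surjective _ x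
            obtain ⟨c, hc⟩ := hspan a ((hker a).1 hx)
            exact Submodule.mem_span_singleton.2 ⟨c, ((Submodule.Quotient.eq _).2 hc).symm⟩
          · rwa [Submodule.span_singleton_le_iff_mem, hker]
        have hne : (Submodule.Quotient.mk f : V ⧸ F (l + 1)) ≠ 0 :=
          fun h => hf' ((Submodule.Quotient.mk_eq_zero _).1 h)
        rw [hspan, finrank_span_singleton hne, countBelow_succ_of_mem hl]
        exact ⟨inferInstance, by omega⟩
      · have hbot : LinearMap.ker g = ⊥ := by
          rw [eq_bot_iff]
          intro x hx
          obtain ⟨a, rfl⟩ := Submodule.Quotient.mk_surjective _ x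
          exact (Submodule.Quotient.mk_eq_zero _).2 (hnot l hl ((hker a).1 hx))
        rw [hbot, finrank_bot, countBelow_succ_of_notMem hl, Nat.sub_self]
        exact ⟨inferInstance, rfl⟩
    obtain ⟨hfk, hrk⟩ := key
    have hfin' : Module.Finite K (V ⧸ F (l + 1)) := by
      have : Module.Finite K ((V ⧸ F (l + 1)) ⧸ LinearMap.ker g) :=
        Module.Finite.equiv (g.quotKerEquivOfSurjective hg).symm
      exact Module.Finite.of_submodule_quotient (LinearMap.ker g)
    refine ⟨hfin', ?_⟩
    have h1 := g.finrank_range_add_finrank_ker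
    rw [LinearMap.range_eq_top.2 hg, finrank_top, hrank, hrk] at h1
    have h2 : countBelow S l ≤ countBelow S (l + 1) := countBelow_mono l.le_succ
    omega

theorem AlgHom.map_sub_smul {K A B : Type*} [CommRing K] [CommRing A] [CommRing B] [Algebra K A]
    [Algebra K B] (φ : A →ₐ[K] B) (a b : A) (c : K) : φ (a - c • b) = φ a - c • φ b := by
  rw [map_sub, map_smul]

namespace PlaneBranch

variable (C : PlaneBranch)

theorem mem_filtration {l : ℕ} {f : C.LocalRing} : f ∈ C.filtration l ↔ (l : ℕ∞) ≤ C.val f :=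
  Iff.rfl

theorem filtration_succ_le (l : ℕ) : C.filtration (l + 1) ≤ C.filtration l := by
  intro f hf
  rw [mem_filtration] at hf ⊢
  exact le_trans (by exact_mod_cast l.le_succ) hf

theorem filtration_zero : C.filtration 0 = ⊤ := by
  refine eq_top_iff.2 fun f _ => ?_
  rw [mem_filtration]
  simp

theorem mem_filtration_succ {l : ℕ} {f : C.LocalRing} :
    f ∈ C.filtration (l + 1) ↔ f ∈ C.filtration l ∧ C.val f ≠ l := by
  rw [mem_filtration, mem_filtration, Nat.cast_add, Nat.cast_one,
    ENat.add_one_le_iff (ENat.natCast_ne_top l), lt_iff_le_and_ne, ne_comm]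

theorem hilbert_eq (l : ℕ) : C.hilbert l = countBelow C.semigroup l := by
  refine (finite_and_finrank_quotient C.filtration C.semigroup C.filtration_zero
    C.filtration_succ_le ?_ ?_ l).2
  · rintro l ⟨f, hf⟩
    refine ⟨f, hf.ge, fun h => (C.mem_filtration_succ.1 h).2 hf, fun a ha => ?_⟩
    by_cases hal : C.val a = l
    · obtain ⟨c, hc⟩ := HolGerm.exists_lt_ord_sub (a := C.pullback a) (b := C.pullback f)
        (hal.trans hf.symm) (by
          change C.val a ≠ ⊤
          rw [hal]
          exact ENat.natCast_ne_top l)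
      refine ⟨c, ?_⟩
      have h1 : C.val (a - c • f) = HolGerm.ord (C.pullback a - c • C.pullback f) :=
        congrArg HolGerm.ord (AlgHom.map_sub_smul C.pullback a f c)
      have h2 : (l : ℕ∞) < C.val (a - c • f) := by
        rw [h1]
        exact hal.symm.trans_lt hc
      exact C.mem_filtration_succ.2 ⟨h2.le, h2.ne'⟩
    · exact ⟨0, by rw [zero_smul, sub_zero]; exact C.mem_filtration_succ.2 ⟨ha, hal⟩⟩
  · exact fun l hl f hf => C.mem_filtration_succ.2 ⟨hf, fun h => hl ⟨f, h⟩⟩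

theorem weight_eq : C.weight = semigroupWeight C.semigroup := by
  funext l
  rw [weight, hilbert_eq, semigroupWeight]

/-! ### The subring of polynomials in the coordinates -/

/-- The first coordinate of the parametrization. -/
def fstCoord : HolGerm ℂ := HolGerm.mk (fun t => (C.n t).1) (analyticAt_fst.comp C.analyticAt_n)

/-- The second coordinate of the parametrization. -/
def sndCoord : HolGerm ℂ := HolGerm.mk (fun t => (C.n t).2) (analyticAt_snd.comp C.analyticAt_n)

/-- The ring of polynomials in the coordinates of the parametrization. -/
def coordRing : Subalgebra ℂ (HolGerm ℂ) := Algebra.adjoin ℂ {C.fstCoord, C.sndCoord}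

theorem coordRing_le_range : C.coordRing ≤ C.pullbackAmbient.range := by
  refine Algebra.adjoin_le ?_
  rintro x (rfl | rfl)
  · exact ⟨HolGerm.mk Prod.fst analyticAt_fst, rfl⟩
  · exact ⟨HolGerm.mk Prod.snd analyticAt_snd, rfl⟩

/-- The functions whose germs are polynomials in the coordinates of the parametrization. -/
def coordFunctions : Subring (ℂ → ℂ) :=
  (C.coordRing.map (HolGerm ℂ).val).toSubring.comap (Germ.coeRingHom (𝓝 0))

theorem mem_coordFunctions {h : ℂ → ℂ} :
    h ∈ C.coordFunctions ↔ ∃ r ∈ C.coordRing, (r : (𝓝 (0 : ℂ)).Germ ℂ) = h := Iff.rfl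

theorem const_mem_coordFunctions (c : ℂ) : (fun _ => c) ∈ C.coordFunctions := by
  refine C.mem_coordFunctions.2 ⟨algebraMap ℂ _ c, C.coordRing.algebraMap_mem c, ?_⟩
  rw [Algebra.algebraMap_eq_smul_one]
  refine (Germ.coe_eq.2 (Eventually.of_forall fun x => ?_) :
    ((c • (1 : ℂ → ℂ) : ℂ → ℂ) : (𝓝 (0 : ℂ)).Germ ℂ) = ((fun _ => c : ℂ → ℂ) : Germ _ ℂ))
  simp

theorem multilinear_mem_coordFunctions {k : ℕ}
    (M : MultilinearMap ℂ (fun _ : Fin k => ℂ × ℂ) ℂ) :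
    (fun t => M fun _ => C.n t) ∈ C.coordFunctions := by
  classical
  have h1 : (fun t => (C.n t).1) ∈ C.coordFunctions :=
    C.mem_coordFunctions.2 ⟨C.fstCoord, Algebra.subset_adjoin (Or.inl rfl), rfl⟩
  have h2 : (fun t => (C.n t).2) ∈ C.coordFunctions :=
    C.mem_coordFunctions.2 ⟨C.sndCoord, Algebra.subset_adjoin (Or.inr rfl), rfl⟩
  have key : (fun t => M fun _ => C.n t) = ∑ s : Finset (Fin k),
      (∏ i, if i ∈ s then fun t => (C.n t).1 else fun t => (C.n t).2) *
        (fun _ => M fun i => if i ∈ s then ((1, 0) : ℂ × ℂ) else (0, 1)) := by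
    funext t
    have e1 : (fun _ : Fin k => C.n t) =
        (fun _ => (C.n t).1 • ((1, 0) : ℂ × ℂ)) + fun _ => (C.n t).2 • ((0, 1) : ℂ × ℂ) := by
      funext i
      ext <;> simp
    rw [e1, M.map_add_univ, Finset.sum_apply]
    refine Finset.sum_congr rfl fun s _ => ?_
    have e2 : s.piecewise (fun _ : Fin k => (C.n t).1 • ((1, 0) : ℂ × ℂ))
        (fun _ => (C.n t).2 • ((0, 1) : ℂ × ℂ)) = fun i =>
        (if i ∈ s then (C.n t).1 else (C.n t).2) •
          (if i ∈ s then ((1, 0) : ℂ × ℂ) else (0, 1)) := by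
      funext i
      by_cases hi : i ∈ s <;> simp [hi]
    rw [e2, M.map_smul_univ, Pi.mul_apply, Finset.prod_apply, smul_eq_mul]
    congr 1
    refine Finset.prod_congr rfl fun i _ => ?_
    by_cases hi : i ∈ s <;> simp [hi]
  rw [key]
  refine sum_mem fun s _ => mul_mem (prod_mem fun i _ => ?_) (C.const_mem_coordFunctions _)
  split_ifs
  exacts [h1, h2]

/-- The Taylor polynomial of `h` serves: its remainder is `O(‖z‖ ^ N)`, and `n(t) = O(t)`. -/
theorem exists_coordRing_le_ord_sub {h : ℂ × ℂ → ℂ} (hh : AnalyticAt ℂ h 0) (N : ℕ) :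
    ∃ r ∈ C.coordRing,
      (N : ℕ∞) ≤ HolGerm.ord (C.pullbackAmbient (HolGerm.mk h hh) - r) := by
  obtain ⟨p, hp⟩ := hh
  have hmem : (fun t => p.partialSum N (C.n t)) ∈ C.coordFunctions := by
    have : (fun t => p.partialSum N (C.n t)) =
        ∑ k ∈ Finset.range N, fun t => (p k).toMultilinearMap fun _ => C.n t := by
      funext t
      rw [Finset.sum_apply]
      rfl
    rw [this]
    exact sum_mem fun k _ => C.multilinear_mem_coordFunctions _
  obtain ⟨r, hr, hrp⟩ := C.mem_coordFunctions.1 hmem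
  refine ⟨r, hr, ?_⟩
  obtain ⟨f, hf, rfl⟩ := HolGerm.exists_mk r
  have hfp : f =ᶠ[𝓝 0] fun t => p.partialSum N (C.n t) := Germ.coe_eq.1 hrp
  have hcomp : AnalyticAt ℂ (h ∘ C.n) 0 :=
    AnalyticAt.comp (by rw [C.n_zero]; exact hp.analyticAt) C.analyticAt_n
  refine HolGerm.le_ord_of_isBigO (hcomp.sub hf) ?_
  have h1 := (hp.isBigO_sub_partialSum_pow N).comp_tendsto C.tendsto_n
  have h2 : C.n =O[𝓝 0] fun t : ℂ => t := by
    have := C.analyticAt_n.differentiableAt.isBigO_sub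
    simpa [C.n_zero] using this
  have h3 : (fun t => ‖C.n t‖ ^ N) =O[𝓝 0] fun t : ℂ => ‖t‖ ^ N := h2.norm_norm.pow N
  refine (h1.trans h3).congr' ?_ EventuallyEq.rfl
  filter_upwards [hfp] with t ht
  simp [ht]

/-- The values of the local ring are the orders of the polynomials in the coordinates. -/
theorem mem_semigroup_iff {k : ℕ} :
    k ∈ C.semigroup ↔ ∃ r ∈ C.coordRing, HolGerm.ord r = k := by
  constructor
  · rintro ⟨f, hf⟩
    obtain ⟨a, rfl⟩ := Ideal.Quotient.mk_surjective f
    obtain ⟨h, hh, rfl⟩ := HolGerm.exists_mk a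
    obtain ⟨r, hr, hle⟩ := C.exists_coordRing_le_ord_sub hh (k + 1)
    refine ⟨r, hr, ?_⟩
    have hk : HolGerm.ord (C.pullbackAmbient (HolGerm.mk h hh)) = k := hf
    set g := C.pullbackAmbient (HolGerm.mk h hh)
    have hlt : (k : ℕ∞) < HolGerm.ord (g - r) :=
      lt_of_lt_of_le (by exact_mod_cast k.lt_succ_self) hle
    apply le_antisymm
    · by_contra! hgt
      have := HolGerm.min_le_ord_add (g - r) r
      rw [sub_add_cancel, hk] at this
      exact (lt_min hlt hgt).not_ge this
    · have := HolGerm.min_le_ord_sub g (g - r)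
      rwa [sub_sub_cancel, hk, min_eq_left hlt.le] at this
  · rintro ⟨r, hr, hk⟩
    obtain ⟨a, rfl⟩ := C.coordRing_le_range hr
    exact ⟨Ideal.Quotient.mk _ a, hk⟩

end PlaneBranch

/-! ### Injectivity of the parametrization and the gcd of the orders -/

theorem AnalyticAt.exists_pow_eq {u : ℂ → ℂ} (hu : AnalyticAt ℂ u 0) (hu0 : u 0 ≠ 0) {e : ℕ}
    (he : e ≠ 0) : ∃ r : ℂ → ℂ, AnalyticAt ℂ r 0 ∧ r 0 ≠ 0 ∧ ∀ᶠ t in 𝓝 0, r t ^ e = u t := by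
  obtain ⟨c, hc⟩ := IsAlgClosed.exists_pow_nat_eq (u 0) (Nat.pos_of_ne_zero he)
  have hc0 : c ≠ 0 := by
    rintro rfl
    rw [zero_pow he] at hc
    exact hu0 hc.symm
  -- Normalizing the value at `0` to `1` puts it in the domain of the principal logarithm.
  have hdiv : AnalyticAt ℂ (fun t => u t / u 0) 0 := hu.div analyticAt_const hu0
  have hlog : AnalyticAt ℂ (fun t => Complex.log (u t / u 0)) 0 :=
    hdiv.clog (by rw [div_self hu0]; exact Complex.one_mem_slitPlane)
  refine ⟨fun t => c * Complex.exp (Complex.log (u t / u 0) / e),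
    analyticAt_const.mul (hlog.div analyticAt_const (by exact_mod_cast he)).cexp,
    mul_ne_zero hc0 (Complex.exp_ne_zero _), ?_⟩
  filter_upwards [hu.continuousAt.eventually_ne hu0] with t ht
  rw [mul_pow, hc, ← Complex.exp_nat_mul, mul_div_cancel₀ _ (by exact_mod_cast he),
    Complex.exp_log (div_ne_zero ht hu0), mul_div_cancel₀ _ hu0]

/-- A local holomorphic automorphism of order `e` preserving the `e`-th power of a coordinate. -/
theorem exists_analyticAt_pow_comp_eq {s : ℂ → ℂ} (hs : AnalyticAt ℂ s 0) (hs0 : s 0 = 0)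
    (hs' : deriv s 0 ≠ 0) {e : ℕ} (he : 2 ≤ e) :
    ∃ σ : ℂ → ℂ, AnalyticAt ℂ σ 0 ∧ σ 0 = 0 ∧ (∀ᶠ t in 𝓝 0, s (σ t) ^ e = s t ^ e) ∧
      ¬ ∀ᶠ t in 𝓝 0, σ t = t := by
  have hζ := Complex.isPrimitiveRoot_exp e (by omega)
  set ζ := Complex.exp (2 * Real.pi * Complex.I / e)
  let φ := hs.hasStrictDerivAt.localInverse _ _ _ hs'
  have hφ : AnalyticAt ℂ φ 0 := by
    have := hs.analyticAt_localInverse hs'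
    rwa [hs0] at this
  have hφ0 : φ 0 = 0 := by
    have : φ (s 0) = 0 := HasStrictFDerivAt.localInverse_apply_image ..
    rwa [hs0] at this
  have hright : ∀ᶠ z in 𝓝 0, s (φ z) = z := by
    have : ∀ᶠ z in 𝓝 (s 0), s (φ z) = z := HasStrictDerivAt.eventually_right_inverse ..
    rwa [hs0] at this
  have hζs : AnalyticAt ℂ (fun t => ζ * s t) 0 := analyticAt_const.mul hs
  have hζs0 : ζ * s 0 = 0 := by rw [hs0, mul_zero]
  have htend : Tendsto (fun t => ζ * s t) (𝓝 0) (𝓝 0) := by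
    have := hζs.continuousAt.tendsto
    rwa [hζs0] at this
  have hsσ : ∀ᶠ t in 𝓝 0, s (φ (ζ * s t)) = ζ * s t := htend.eventually hright
  -- In the coordinate `s` the automorphism is multiplication by a primitive `e`-th root of unity.
  refine ⟨fun t => φ (ζ * s t), ?_, by simp only [hζs0, hφ0], ?_, ?_⟩
  · exact AnalyticAt.comp (f := fun t => ζ * s t) (by rw [hζs0]; exact hφ) hζs
  · filter_upwards [hsσ] with t ht
    rw [ht, mul_pow, hζ.pow_eq_one, one_mul]
  · intro hid
    apply hs'
    have : s =ᶠ[𝓝 0] fun _ => 0 := by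
      filter_upwards [hsσ, hid] with t h1 h2
      rw [h2] at h1
      have h3 : (ζ - 1) * s t = 0 := by linear_combination -h1
      exact (mul_eq_zero.1 h3).resolve_left (sub_ne_zero.2 (hζ.ne_one (by omega)))
    rw [this.deriv_eq, deriv_const]

namespace HolGerm

/-- Composition of germs with a germ `(ℂ, 0) → (ℂ, 0)`. -/
def comp (σ : ℂ → ℂ) (hσ : AnalyticAt ℂ σ 0) (hσ0 : σ 0 = 0) : HolGerm ℂ →ₐ[ℂ] HolGerm ℂ where
  toFun h := ⟨(h : (𝓝 (0 : ℂ)).Germ ℂ).compTendsto σ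
      (by simpa only [hσ0] using hσ.continuousAt.tendsto), by
    obtain ⟨_, h, hh, rfl⟩ := h
    exact ⟨h ∘ σ, AnalyticAt.comp (by rwa [hσ0]) hσ, (Germ.coe_compTendsto h _).symm⟩⟩
  map_one' := rfl
  map_zero' := rfl
  map_mul' := by
    rintro ⟨_, a, ha, rfl⟩ ⟨_, b, hb, rfl⟩
    rfl
  map_add' := by
    rintro ⟨_, a, ha, rfl⟩ ⟨_, b, hb, rfl⟩
    rfl
  commutes' r := by
    apply Subtype.ext
    simp only [Algebra.algebraMap_eq_smul_one]
    rfl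

variable {σ : ℂ → ℂ} {hσ : AnalyticAt ℂ σ 0} {hσ0 : σ 0 = 0}

theorem comp_mk {h : ℂ → ℂ} (hh : AnalyticAt ℂ h 0) :
    comp σ hσ hσ0 (mk h hh) = mk (h ∘ σ) (AnalyticAt.comp (by rwa [hσ0]) hσ) := rfl

theorem ord_le_ord_comp (a : HolGerm ℂ) : ord a ≤ ord (comp σ hσ hσ0 a) := by
  obtain ⟨h, hh, rfl⟩ := exists_mk a
  rw [comp_mk, ord_mk, ord_mk, AnalyticAt.analyticOrderAt_comp (by rwa [hσ0]) hσ, hσ0]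
  refine le_mul_of_one_le_right zero_le (Order.one_le_iff_ne_zero.2 ?_)
  simp only [sub_zero]
  rw [hσ.analyticOrderAt_ne_zero]
  exact hσ0

/-- The quotient `τ` need not lie in `R`. Clearing denominators by powers of `q` keeps successive
remainders within reach of the divisibility hypothesis on `R`. -/
theorem pow_mul_sub_smul_mem {A : Type*} [CommRing A] [Algebra ℂ A] {R : Subalgebra ℂ A}
    {q τ z : A} (hq : q ∈ R) (hqτ : q * τ ∈ R) {j : ℕ} (hj : q ^ j * z ∈ R) (c : ℂ) (i : ℕ) :
    q ^ (j + i) * (z - c • τ ^ i) ∈ R := by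
  have : q ^ (j + i) * (z - c • τ ^ i) = q ^ i * (q ^ j * z) - c • (q ^ j * (q * τ) ^ i) := by
    rw [mul_sub, mul_smul_comm]
    congr 1
    · ring
    · congr 1
      ring
  rw [this]
  exact sub_mem (mul_mem (pow_mem hq _) hj)
    (R.smul_mem (mul_mem (pow_mem hq _) (pow_mem hqτ _)) c)

theorem sub_sub_smul_mem_adjoin {A : Type*} [CommRing A] [Algebra ℂ A] {r z τ : A}
    (h : r - z ∈ Algebra.adjoin ℂ {τ}) (c : ℂ) (i : ℕ) :
    r - (z - c • τ ^ i) ∈ Algebra.adjoin ℂ {τ} := by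
  rw [← sub_add]
  exact add_mem h (Subalgebra.smul_mem _ (pow_mem (Algebra.self_mem_adjoin_singleton ℂ τ) _) c)

/-- If all orders in a subalgebra `R` are divisible by the order `e` of a quotient `τ` of two
elements of `R`, then the elements of `R` are power series in `τ`. -/
theorem exists_sub_mem_adjoin {R : Subalgebra ℂ (HolGerm ℂ)} {q τ : HolGerm ℂ} {e k : ℕ}
    (hR : ∀ r ∈ R, ∀ n : ℕ, ord r = n → e ∣ n) (hq : q ∈ R) (hqτ : q * τ ∈ R) (hqk : ord q = k)
    (hτ : ord τ = e) {r : HolGerm ℂ} (hr : r ∈ R) (N : ℕ) :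
    ∃ z, (∃ j : ℕ, q ^ j * z ∈ R) ∧ (N : ℕ∞) ≤ ord z ∧ r - z ∈ Algebra.adjoin ℂ {τ} := by
  induction N with
  | zero => exact ⟨r, ⟨0, by simpa using hr⟩, by simp, by simp⟩
  | succ N ih =>
    obtain ⟨z, ⟨j, hj⟩, hz, hrz⟩ := ih
    rcases hz.eq_or_lt with hz | hz
    · have h1 : e ∣ j * k + N := hR _ hj _ (by
        rw [ord_mul, ord_pow, hqk, ← hz]
        push_cast
        rfl)
      have h2 : e ∣ N := (Nat.dvd_add_right (dvd_mul_of_dvd_right (hR q hq k hqk) j)).1 h1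
      obtain ⟨i, rfl⟩ := h2
      obtain ⟨c, hc⟩ := exists_lt_ord_sub (a := z) (b := τ ^ i) (by
        rw [← hz, ord_pow, hτ]
        push_cast
        ring) (by rw [← hz]; exact ENat.natCast_ne_top _)
      refine ⟨z - c • τ ^ i, ⟨j + i, ?_⟩, ?_, ?_⟩
      · exact pow_mul_sub_smul_mem hq hqτ hj c i
      · rw [← hz] at hc
        rw [Nat.cast_add, Nat.cast_one]
        exact Order.add_one_le_of_lt hc
      · exact sub_sub_smul_mem_adjoin hrz c i
    · refine ⟨z, ⟨j, hj⟩, ?_, hrz⟩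
      rw [Nat.cast_add, Nat.cast_one]
      exact Order.add_one_le_of_lt hz

end HolGerm

namespace PlaneBranch

variable (C : PlaneBranch)

/-- As the parametrization is injective, the gcd of the orders is `1`. -/
theorem ord_ne_add {e : ℕ} (he : 2 ≤ e)
    (hdvd : ∀ r ∈ C.coordRing, ∀ n : ℕ, HolGerm.ord r = n → e ∣ n) {p q : HolGerm ℂ}
    (hp : p ∈ C.coordRing) (hq : q ∈ C.coordRing) {k : ℕ} (hqk : HolGerm.ord q = k) :
    HolGerm.ord p ≠ (k + e : ℕ) := by
  intro hpk
  obtain ⟨P, hP, rfl⟩ := HolGerm.exists_mk p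
  obtain ⟨Q, hQ, rfl⟩ := HolGerm.exists_mk q
  obtain ⟨P', hP', hP0, hPP⟩ := hP.analyticOrderAt_eq_natCast.1 hpk
  obtain ⟨Q', hQ', hQ0, hQQ⟩ := hQ.analyticOrderAt_eq_natCast.1 hqk
  -- With this root, `P / Q = t ^ e * u ^ e` is the `e`-th power of the local coordinate `s = t *
  -- u`.
  obtain ⟨u, hu, hu0, hue⟩ := (hP'.div hQ' hQ0).exists_pow_eq (div_ne_zero hP0 hQ0)
    (show e ≠ 0 by omega)
  have hs : AnalyticAt ℂ (fun t => t * u t) 0 := analyticAt_id.mul hu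
  have hs' : deriv (fun t => t * u t) 0 ≠ 0 := by
    have := ((hasDerivAt_id (0 : ℂ)).mul hu.differentiableAt.hasDerivAt).deriv
    change deriv (fun t => t * u t) 0 = _ at this
    rw [this]
    simpa using hu0
  obtain ⟨σ, hσ, hσ0, hσe, hσid⟩ :=
    exists_analyticAt_pow_comp_eq hs (zero_mul _) hs' he
  set s : ℂ → ℂ := fun t => t * u t with hsdef
  have hse : AnalyticAt ℂ (fun t => s t ^ e) 0 := hs.pow e
  set τ := HolGerm.mk _ hse
  have hqτ : HolGerm.mk Q hQ * τ = HolGerm.mk P hP := by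
    refine (HolGerm.mk_mul hQ hse).trans (HolGerm.mk_eq_mk.2 ?_)
    filter_upwards [hPP, hQQ, hue, hQ'.continuousAt.eventually_ne hQ0] with t h1 h2 h3 h4
    simp only [sub_zero, smul_eq_mul] at h1 h2
    rw [Pi.mul_apply, h1, h2, hsdef]
    simp only [mul_pow, h3, Pi.div_apply]
    field_simp
    ring
  have hτ : HolGerm.ord τ = e := by
    have h1 := HolGerm.ord_mul (HolGerm.mk Q hQ) τ
    rw [hqτ, hpk, hqk, Nat.cast_add] at h1
    exact (WithTop.add_left_cancel (ENat.natCast_ne_top k) h1).symm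
  have hcompτ : HolGerm.comp σ hσ hσ0 τ = τ :=
    (HolGerm.comp_mk hse).trans (HolGerm.mk_eq_mk.2 hσe)
  -- Up to a remainder of arbitrarily high order `r` is a polynomial in `τ`, which `σ` fixes;
  -- composition with `σ` does not lower the order of the remainder.
  have hfix : ∀ r ∈ C.coordRing, HolGerm.comp σ hσ hσ0 r = r := by
    intro r hr
    rw [← sub_eq_zero, ← HolGerm.ord_eq_top, ENat.eq_top_iff_forall_ge]
    intro N
    obtain ⟨z, -, hz, hrz⟩ := HolGerm.exists_sub_mem_adjoin hdvd hq (by rwa [hqτ]) hqk hτ hr N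
    have hrz' : HolGerm.comp σ hσ hσ0 (r - z) = r - z := by
      have hle : Algebra.adjoin ℂ {τ} ≤ AlgHom.equalizer (HolGerm.comp σ hσ hσ0) (AlgHom.id ℂ _) :=
        Algebra.adjoin_le (by rintro _ rfl; exact hcompτ)
      exact hle hrz
    have : HolGerm.comp σ hσ hσ0 r - r = HolGerm.comp σ hσ hσ0 z - z := by
      rw [map_sub] at hrz'
      linear_combination hrz'
    rw [this]
    exact (le_min (hz.trans (HolGerm.ord_le_ord_comp z)) hz).trans (HolGerm.min_le_ord_sub _ _)
  -- Both coordinates are fixed, so `n ∘ σ = n` near `0`, while `σ` is not the identity there.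
  have h1 : (fun t => (C.n t).1) ∘ σ =ᶠ[𝓝 0] fun t => (C.n t).1 :=
    HolGerm.mk_eq_mk.1 ((HolGerm.comp_mk _).symm.trans <| hfix C.fstCoord (Algebra.subset_adjoin (Or.inl rfl)))
  have h2 : (fun t => (C.n t).2) ∘ σ =ᶠ[𝓝 0] fun t => (C.n t).2 :=
    HolGerm.mk_eq_mk.1 ((HolGerm.comp_mk _).symm.trans <| hfix C.sndCoord (Algebra.subset_adjoin (Or.inr rfl)))
  obtain ⟨V, hV, hinj⟩ := C.injective_n
  have hσt : Tendsto σ (𝓝 0) (𝓝 0) := by simpa only [hσ0] using hσ.continuousAt.tendsto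
  apply hσid
  filter_upwards [h1, h2, hV, hσt hV] with t e1 e2 e3 e4
  exact hinj e4 e3 (Prod.ext e1 e2)

end PlaneBranch

/-! ### The valuation of a branch on polynomials in its coordinates -/

theorem range_eval₂_aeval {A : Type*} [CommRing A] [Algebra ℂ A] (a b : A) (r : A) :
    (∃ P : ℂ[X][X], P.eval₂ (aeval (R := ℂ) a).toRingHom b = r) ↔
      r ∈ Algebra.adjoin ℂ {a, b} := by
  have ha : a ∈ Algebra.adjoin ℂ {a, b} := Algebra.subset_adjoin (Or.inl rfl)
  have hb : b ∈ Algebra.adjoin ℂ {a, b} := Algebra.subset_adjoin (Or.inr rfl)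
  constructor
  · rintro ⟨P, rfl⟩
    rw [eval₂_eq_sum_range]
    refine sum_mem fun i _ => mul_mem ?_ (pow_mem hb i)
    exact Algebra.adjoin_mono (by simp) (aeval_mem_adjoin_singleton ℂ a)
  · intro hr
    induction hr using Algebra.adjoin_induction with
    | mem x hx =>
      rcases hx with rfl | rfl
      · exact ⟨C X, by simp⟩
      · exact ⟨X, by simp⟩
    | algebraMap c => exact ⟨C (C c), by simp⟩
    | add x y _ _ h1 h2 =>
      obtain ⟨P, rfl⟩ := h1
      obtain ⟨Q, rfl⟩ := h2
      exact ⟨P + Q, eval₂_add _ _⟩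
    | mul x y _ _ h1 h2 =>
      obtain ⟨P, rfl⟩ := h1
      obtain ⟨Q, rfl⟩ := h2
      exact ⟨P * Q, eval₂_mul _ _⟩

theorem eval₂_aeval_sub {A : Type*} [CommRing A] [Algebra ℂ A] (a b : A) (P Q : ℂ[X][X]) (c : ℂ) :
    (P - C (C c) * Q).eval₂ (aeval (R := ℂ) a).toRingHom b =
      P.eval₂ (aeval (R := ℂ) a).toRingHom b - c • Q.eval₂ (aeval (R := ℂ) a).toRingHom b := by
  simp [Algebra.smul_def]

theorem eval₂_aeval_C_C {A : Type*} [CommRing A] [Algebra ℂ A] (a b : A) (c : ℂ) :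
    (C (C c) : ℂ[X][X]).eval₂ (aeval (R := ℂ) a).toRingHom b = algebraMap ℂ A c := by
  simp

theorem eval₂_aeval_C_X {A : Type*} [CommRing A] [Algebra ℂ A] (a b : A) :
    (C X : ℂ[X][X]).eval₂ (aeval (R := ℂ) a).toRingHom b = a := by
  simp

theorem HolGerm.isCurveValuation {a b : HolGerm ℂ} {m : ℕ} (ha : ord a = m)
    (hb : (m : ℕ∞) ≤ ord b) :
    IsCurveValuation m fun P : ℂ[X][X] => ord (P.eval₂ (aeval (R := ℂ) a).toRingHom b) where
  map_zero := by rw [eval₂_zero, ord_zero]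
  map_mul P Q := by rw [eval₂_mul, ord_mul]
  min_le_add P Q := by
    rw [eval₂_add]
    exact min_le_ord_add _ _
  map_const c hc := by rw [eval₂_aeval_C_C, ord_algebraMap hc]
  exists_lt_sub P Q h hP := by
    obtain ⟨c, hc⟩ := exists_lt_ord_sub h hP
    exact ⟨c, by rwa [eval₂_aeval_sub]⟩
  map_C_X := by rw [eval₂_aeval_C_X, ha]
  le_map_X := by rwa [eval₂_X]

namespace PlaneBranch

variable (C : PlaneBranch)

/-- The coordinates are swapped if necessary so that the first has the smaller order. They are not
both zero, since the parametrization is injective. -/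
theorem exists_coord : ∃ (a b : HolGerm ℂ) (m : ℕ), C.coordRing = Algebra.adjoin ℂ {a, b} ∧
    0 < m ∧ HolGerm.ord a = m ∧ (m : ℕ∞) ≤ HolGerm.ord b := by
  have h1 : HolGerm.ord C.fstCoord ≠ 0 := by
    refine analyticOrderAt_ne_zero.2 ⟨analyticAt_fst.comp C.analyticAt_n, ?_⟩
    change (C.n 0).1 = 0
    rw [C.n_zero]
    rfl
  have h2 : HolGerm.ord C.sndCoord ≠ 0 := by
    refine analyticOrderAt_ne_zero.2 ⟨analyticAt_snd.comp C.analyticAt_n, ?_⟩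
    change (C.n 0).2 = 0
    rw [C.n_zero]
    rfl
  have hne : ¬ (HolGerm.ord C.fstCoord = ⊤ ∧ HolGerm.ord C.sndCoord = ⊤) := by
    rintro ⟨e1, e2⟩
    have e1 : ∀ᶠ t in 𝓝 0, (C.n t).1 = 0 := analyticOrderAt_eq_top.1 e1
    have e2 : ∀ᶠ t in 𝓝 0, (C.n t).2 = 0 := analyticOrderAt_eq_top.1 e2
    obtain ⟨V, hV, hinj⟩ := C.injective_n
    have h0 : ∀ᶠ t in 𝓝 (0 : ℂ), t = 0 := by
      filter_upwards [e1, e2, hV] with t h1 h2 h3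
      refine hinj h3 (mem_of_mem_nhds hV) ?_
      rw [C.n_zero]
      exact Prod.ext h1 h2
    have hid : analyticOrderAt (id : ℂ → ℂ) 0 = ⊤ := analyticOrderAt_eq_top.2 h0
    rw [analyticOrderAt_id] at hid
    exact ENat.one_ne_top hid
  rcases le_total (HolGerm.ord C.fstCoord) (HolGerm.ord C.sndCoord) with hle | hle
  · obtain ⟨m, hm⟩ := ENat.ne_top_iff_exists.1
      (fun h => hne ⟨h, top_le_iff.1 (h ▸ hle)⟩ : HolGerm.ord C.fstCoord ≠ ⊤)
    refine ⟨C.fstCoord, C.sndCoord, m, rfl, Nat.pos_of_ne_zero ?_, hm.symm, hm ▸ hle⟩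
    rintro rfl
    exact h1 hm.symm
  · obtain ⟨m, hm⟩ := ENat.ne_top_iff_exists.1
      (fun h => hne ⟨top_le_iff.1 (h ▸ hle), h⟩ : HolGerm.ord C.sndCoord ≠ ⊤)
    refine ⟨C.sndCoord, C.fstCoord, m, ?_, Nat.pos_of_ne_zero ?_, hm.symm, hm ▸ hle⟩
    · rw [Set.pair_comm]
      rfl
    · rintro rfl
      exact h2 hm.symm

/-- The semigroup of a plane branch is generated by a telescopic sequence. -/
theorem exists_telescopic : ∃ m G f t, 0 < m ∧ Telescopic m G 1 f t ∧
    C.semigroup = AddSubmonoid.closure G := by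
  obtain ⟨a, b, m, hR, hm, ha, hb⟩ := C.exists_coord
  have hmem : ∀ P : ℂ[X][X], P.eval₂ (aeval (R := ℂ) a).toRingHom b ∈ C.coordRing := fun P => by
    rw [hR]
    exact (range_eval₂_aeval a b _).1 ⟨P, rfl⟩
  have hex : ∀ r ∈ C.coordRing, ∃ P : ℂ[X][X], P.eval₂ (aeval (R := ℂ) a).toRingHom b = r :=
    fun r hr => (range_eval₂_aeval a b _).2 (hR ▸ hr)
  obtain ⟨G, f, t, hT, hG⟩ := (HolGerm.isCurveValuation ha hb).exists_telescopic hm (by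
    intro e he hdvd P Q k hQ
    refine C.ord_ne_add he ?_ (hmem P) (hmem Q) hQ
    intro r hr n hn
    obtain ⟨P, rfl⟩ := hex r hr
    exact hdvd P n hn)
  refine ⟨m, G, f, t, hm, hT, ?_⟩
  ext k
  rw [mem_semigroup_iff, SetLike.mem_coe, ← hG]
  constructor
  · rintro ⟨r, hr, hk⟩
    obtain ⟨P, rfl⟩ := hex r hr
    exact ⟨P, hk⟩
  · rintro ⟨P, hP⟩
    exact ⟨_, hmem P, hP⟩

end PlaneBranch

/-! ### Conclusion -/

/-- The indices are replaced by equations so that the case distinction applies to a sequence whose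
gcd is fixed to be `1`. -/
theorem Telescopic.eq_base_or_exists_step {m : ℕ} {G : Set ℕ} {e : ℕ} {f : ℤ} {t : ℕ}
    (h : Telescopic m G e f t) : (G = {m} ∧ e = m) ∨
      ∃ G' e' f' t' b, Telescopic m G' e' f' t' ∧ t' < b ∧ ¬ e' ∣ b ∧ G = insert b G' ∧
        e = e'.gcd b ∧ t = e' / e'.gcd b * b := by
  cases h with
  | base => exact Or.inl ⟨rfl, rfl⟩
  | @step G' e' f' t' b h htb heb => exact Or.inr ⟨G', e', f', t', b, h, htb, heb, rfl, rfl, rfl⟩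

namespace PlaneBranch

variable {C : PlaneBranch}

/-- All generators but the last one lie in the initial part, if there are at least three. -/
theorem mem_initialPart {m : ℕ} {G : Set ℕ} {e : ℕ} {f : ℤ} {t : ℕ} (h : Telescopic m G e f t)
    (hm : 0 < m) {β b : ℕ} (htβ : t < β) (heβ : ¬ e ∣ β) (hb : e / e.gcd β * β < b)
    (hdb : ¬ e.gcd β ∣ b) (hgcd : (e.gcd β).gcd b = 1)
    (hS : C.semigroup = AddSubmonoid.closure (insert b (insert β G))) {x : ℕ}
    (hx : x ∈ insert β G) : x ∈ C.initialPart := by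
  have h2 := (h.step β htβ heβ).step b hb hdb
  rw [hgcd, Nat.div_one] at h2
  obtain ⟨c, hc, hsym⟩ := h2.exists_conductor hm
  have hc' : (c : ℤ) = f + ((e / e.gcd β : ℕ) - 1) * β + ((e.gcd β : ℕ) - 1) * b + 1 := by
    linarith
  have hw : C.weight = semigroupWeight (AddSubmonoid.closure (insert b (insert β G))) := by
    rw [C.weight_eq, hS]
  refine ⟨?_, ?_, ?_⟩
  · rw [hS]
    exact AddSubmonoid.subset_closure (Or.inr hx)
  · rw [PlaneBranch.e, hw]
    -- It suffices that `w(x)` itself is stable; a violation at level `k ≥ w(x)` would be a peak of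
    -- height at least two that is higher than `w(x)`.
    refine csInf_le hsym.bddBelow_stable (LatticeCohomology.mem_stable ⟨x, le_rfl⟩ ?_)
    intro k hk p z q hpz hzq hp hq
    by_contra! hlt
    have := h.weight_le_of_peak hm htβ heβ hb hdb hgcd hc' hpz hzq (by omega) (by omega) hx
    omega
  · have h3 := h.two_mul_le_conductor hm htβ heβ hb hdb hc' hx
    have h4 := hsym.two_mul_ncard_compl
    rw [delta, hS]
    omega

/-- Every generating set contains the telescopic one, so a minimal one equals it. -/
theorem isMinimalGenerators_range_eq {m : ℕ} {G : Set ℕ} {e : ℕ} {f : ℤ} {t : ℕ}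
    (h : Telescopic m G e f t) (hm : 0 < m) (hS : C.semigroup = AddSubmonoid.closure G) {g : ℕ}
    {β : Fin (g + 1) → ℕ} (hβ : C.IsMinimalGenerators g β) : Set.range β = G := by
  have h1 : (AddSubmonoid.closure (Set.range β) : Set ℕ) = C.semigroup := hβ.2.prop
  have h2 : G ⊆ Set.range β := h.subset_of_closure_eq hm (SetLike.coe_injective (h1.trans hS))
  exact le_antisymm (hβ.2.le_of_le hS.symm h2) h2

end PlaneBranch

end

theorem mainTheorem3 (C : PlaneBranch) :
    IsLeast (LatticeCohomology.stable C.weight) C.e ∧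
    (∀ (g : ℕ) (β : Fin (g + 1) → ℕ), C.IsMinimalGenerators g β →
      (2 ≤ g →
        β ⟨g - 1, by omega⟩ ∈ C.initialPart ∧
        ∀ i : Fin (g + 1), (i : ℕ) ≤ g - 1 → β i ∈ C.initialPart) ∧
      (C.initialPart = {0} → g ≤ 1)) ∧
    (C.initialPart = {0} →
      ∃ a b : ℕ, 1 ≤ a ∧ 1 ≤ b ∧ Nat.gcd a b = 1 ∧
        (AddSubmonoid.closure {a, b} : Set ℕ) = C.semigroup) := by
  obtain ⟨m, G, f, t, hm, hG, hS⟩ := C.exists_telescopic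
  have part1 : ∀ (g : ℕ) (β : Fin (g + 1) → ℕ), C.IsMinimalGenerators g β → 2 ≤ g →
      ∀ i : Fin (g + 1), (i : ℕ) ≤ g - 1 → β i ∈ C.initialPart := by
    intro g β hβ hg i hi
    have hrange := PlaneBranch.isMinimalGenerators_range_eq hG hm hS hβ
    have hmem : ∀ j, β j ∈ G := fun j => hrange ▸ ⟨j, rfl⟩
    have hlt : ∀ j k : Fin (g + 1), (j : ℕ) < k → β j < β k := fun j k hjk => hβ.1 hjk
    have h01 := hlt ⟨0, by omega⟩ ⟨1, by omega⟩ Nat.zero_lt_one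
    have h12 := hlt ⟨1, by omega⟩ ⟨2, by omega⟩ Nat.one_lt_two
    have m0 := hmem ⟨0, by omega⟩
    have m1 := hmem ⟨1, by omega⟩
    have m2 := hmem ⟨2, by omega⟩
    rcases hG.eq_base_or_exists_step with ⟨rfl, -⟩ | ⟨G', e', f', t', b, hG', htb, heb, rfl, he, -⟩
    · simp only [Set.mem_singleton_iff] at m0 m1
      omega
    rcases hG'.eq_base_or_exists_step with ⟨rfl, -⟩ |
      ⟨G'', e'', f'', t'', b', hG'', htb', heb', rfl, rfl, rfl⟩
    · simp only [Set.mem_singleton_iff, Set.mem_insert_iff] at m0 m1 m2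
      omega
    refine PlaneBranch.mem_initialPart hG'' hm htb' heb' htb heb he.symm hS ?_
    -- The last telescopic member `b` is the largest generator, while `β i < β g` for `i ≤ g - 1`.
    refine (hmem i).resolve_left fun hib => ?_
    have h1 := hlt i ⟨g, by omega⟩ (by simp only; omega)
    rcases hmem ⟨g, by omega⟩ with h2 | h2
    · omega
    · have := hG'.le_bound hm _ h2
      omega
  refine ⟨?_, fun g β hβ => ⟨fun hg => ⟨part1 g β hβ hg _ le_rfl, part1 g β hβ hg⟩, ?_⟩, ?_⟩
  · obtain ⟨c, -, hsym⟩ := hG.exists_conductor hm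
    rw [PlaneBranch.e, C.weight_eq, hS]
    exact hsym.isLeast_stable
  · intro h0
    by_contra! hg
    have h1 := part1 g β hβ hg ⟨0, by omega⟩ (Nat.zero_le _)
    rw [h0, Set.mem_singleton_iff] at h1
    have h2 : β ⟨0, by omega⟩ ∈ G :=
      PlaneBranch.isMinimalGenerators_range_eq hG hm hS hβ ▸ ⟨_, rfl⟩
    exact (hG.pos_of_mem hm _ h2).ne' h1
  · intro h0
    rcases hG.eq_base_or_exists_step with ⟨rfl, rfl⟩ | ⟨G', e', f', t', b, hG', htb, heb, rfl, he, -⟩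
    · exact ⟨1, 1, le_rfl, le_rfl, rfl, by rw [hS]; simp⟩
    rcases hG'.eq_base_or_exists_step with ⟨rfl, rfl⟩ |
      ⟨G'', e'', f'', t'', b', hG'', htb', heb', rfl, rfl, rfl⟩
    · exact ⟨b, e', by omega, hm, by rw [Nat.gcd_comm]; exact he.symm, hS.symm⟩
    -- With at least three generators the positive number `m` would belong to the initial part.
    · have h1 := PlaneBranch.mem_initialPart hG'' hm htb' heb' htb heb he.symm hS
        (Or.inr hG''.mem)
      rw [h0, Set.mem_singleton_iff] at h1
      omega
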